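/- Let $s\in(0,1)$ and $n\ge 2$. For an open set $\Omega\subset\mathbb{R}^m$ let $\mathcal{F}_m u(\xi)=(2\pi)^{-m/2}\int_{\mathbb{R}^m}e^{-i\xi\cdot x}u(x)\,dx$ be the Fourier transform on $L_2(\mathbb{R}^m)$, let $$\widetilde H^s(\Omega)=\{u\in L_2(\mathbb{R}^m):\ |\xi|^s\mathcal{F}_m u\in L_2(\mathbb{R}^m),\ \operatorname{supp}u\subset\overline{\Omega}\},$$ and let $\mathcal{A}_s^\Omega$ (the restricted Dirichlet fractional Laplacian) be the self-adjoint operator generated by the closed quadratic form $$a_s^\Omega[u]=\int_{\mathbb{R}^m}|\xi|^{2s}\,|\mathcal{F}_m u(\xi)|^2\,d\xi,\qquad \operatorname{Dom}(a_s^\Omega)=\widetilde H^s(\Omega),$$ in the closure of $\widetilde H^s(\Omega)$ in $L_2(\mathbb{R}^m)$ (this closure is $L_2(\Omega)$ whenever $\partial\Omega$ has measure zero). Theorem. Let $\omega$ be a bounded domain in $\mathbb{R}^{n-1}$ and let $Q=\omega\times\mathbb{R}\subset\mathbb{R}^n$ be the straight tube over $\omega$. Then the operator $\mathcal{A}_s^\omega$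 has a smallest eigenvalue $\Lambda_s$, and $$\sigma(\mathcal{A}_s^Q)=\sigma_{ess}(\mathcal{A}_s^Q)=[\Lambda_s,+\infty).$$ Here $\sigma$ is the spectrum and $\sigma_{ess}$ the essential spectrum, i.e. the set of all $\lambda$ for which there is an orthonormal sequence $(u_k)$ in $\operatorname{Dom}(\mathcal{A}_s^Q)$ with $\|\mathcal{A}_s^Qu_k-\lambda u_k\|\to 0$. -/

import Mathlib

open MeasureTheory Set Filter Topology FourierTransform
open scoped ComplexConjugate

noncomputable section

namespace FracTube

/-! ### The Fourier transform and the Sobolev spaces -/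

/-- The `n`-dimensional Euclidean space. -/
abbrev E (n : ℕ) : Type := EuclideanSpace ℝ (Fin n)

/-- The complex Hilbert space `L₂(ℝⁿ)`. -/
abbrev L2 (n : ℕ) : Type := Lp ℂ 2 (volume : Measure (E n))

/-- The Fourier transform in the normalization
`F u (ξ) = (2π)^(-n/2) ∫ exp(-i ξ·x) u(x) dx`, extended to `L₂(ℝⁿ)` by continuity.
Mathlib's Plancherel transform `𝓕` extends `u ↦ ∫ exp(-2πi η·x) u(x) dx`, hence the rescaling
`η = ξ / (2π)`. -/
def fourierN {n : ℕ} (u : L2 n) (ξ : E n) : ℂ :=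
  (((2 * Real.pi) ^ (-(n : ℝ) / 2) : ℝ) : ℂ) * (𝓕 u : L2 n) ((2 * Real.pi)⁻¹ • ξ)

theorem ae_comp_scale {n : ℕ} {p : E n → Prop} (h : ∀ᵐ ξ, p ξ) :
    ∀ᵐ ξ : E n, p ((2 * Real.pi)⁻¹ • ξ) := by
  have hc : ((2 * Real.pi)⁻¹ : ℝ) ≠ 0 := by positivity
  have hq : Measure.QuasiMeasurePreserving (fun ξ : E n => (2 * Real.pi)⁻¹ • ξ) volume volume := by
    refine ⟨by fun_prop, ?_⟩
    rw [Measure.map_addHaar_smul volume hc]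
    exact Measure.smul_absolutelyContinuous
  exact hq.ae h

theorem fourierN_add {n : ℕ} (u v : L2 n) :
    ∀ᵐ ξ, fourierN (u + v) ξ = fourierN u ξ + fourierN v ξ := by
  have h : ∀ᵐ ξ : E n, (𝓕 (u + v) : L2 n) ξ = (𝓕 u : L2 n) ξ + (𝓕 v : L2 n) ξ := by
    rw [FourierTransform.fourier_add]
    exact Lp.coeFn_add _ _
  filter_upwards [ae_comp_scale h] with ξ hξ
  simp only [fourierN, hξ, mul_add]

theorem fourierN_smul {n : ℕ} (c : ℂ) (u : L2 n) :
    ∀ᵐ ξ, fourierN (c • u) ξ = c * fourierN u ξ := by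
  have h : ∀ᵐ ξ : E n, (𝓕 (c • u) : L2 n) ξ = c * (𝓕 u : L2 n) ξ := by
    rw [FourierTransform.fourier_smul]
    exact Lp.coeFn_smul _ _
  filter_upwards [ae_comp_scale h] with ξ hξ
  simp only [fourierN, hξ]
  ring

/-- `u ∈ Hˢ(ℝⁿ)`: the function `|ξ|ˢ F u (ξ)` is square integrable. -/
def MemHs {n : ℕ} (s : ℝ) (u : L2 n) : Prop :=
  MemLp (fun ξ : E n => ((‖ξ‖ ^ s : ℝ) : ℂ) * fourierN u ξ) 2 volume

theorem MemHs.add {n : ℕ} {s : ℝ} {u v : L2 n} (hu : MemHs s u) (hv : MemHs s v) :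
    MemHs s (u + v) := by
  refine (MemLp.add hu hv).ae_eq ?_
  filter_upwards [fourierN_add u v] with ξ hξ
  simp only [Pi.add_apply, hξ, mul_add]

theorem MemHs.smul {n : ℕ} {s : ℝ} {u : L2 n} (c : ℂ) (hu : MemHs s u) :
    MemHs s (c • u) := by
  refine (MemLp.const_mul hu c).ae_eq ?_
  filter_upwards [fourierN_smul c u] with ξ hξ
  simp only [hξ]
  ring

/-- The space `H̃ˢ(Ω)` of all `u ∈ Hˢ(ℝⁿ)` with `supp u ⊂ closure Ω`, i.e. `u` vanishes almost
everywhere on the open complement of `closure Ω`. -/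
def formDomain {n : ℕ} (s : ℝ) (Ω : Set (E n)) : Submodule ℂ (L2 n) where
  carrier := {u | MemHs s u ∧ ∀ᵐ x, x ∉ closure Ω → u x = 0}
  add_mem' := by
    rintro u v ⟨hu, hu0⟩ ⟨hv, hv0⟩
    refine ⟨hu.add hv, ?_⟩
    filter_upwards [Lp.coeFn_add u v, hu0, hv0] with x hx h1 h2 hxΩ
    rw [hx, Pi.add_apply, h1 hxΩ, h2 hxΩ, add_zero]
  zero_mem' := by
    refine ⟨?_, ?_⟩
    · have h := fourierN_smul (0 : ℂ) (0 : L2 n)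
      refine (MemLp.zero' (ε := ℂ)).ae_eq ?_
      filter_upwards [h] with ξ hξ
      rw [zero_smul, zero_mul] at hξ
      rw [hξ, mul_zero]
    · filter_upwards [Lp.coeFn_zero ℂ 2 (volume : Measure (E n))] with x hx _
      exact hx
  smul_mem' := by
    rintro c u ⟨hu, hu0⟩
    refine ⟨hu.smul c, ?_⟩
    filter_upwards [Lp.coeFn_smul c u, hu0] with x hx h1 hxΩ
    rw [hx, Pi.smul_apply, h1 hxΩ, smul_zero]

/-! ### The quadratic form and the restricted Dirichlet fractional Laplacian -/

/-- The sesquilinear form `a[v, u] = ∫ |ξ|^(2s) conj (F v (ξ)) F u (ξ) dξ`; its diagonal is the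
quadratic form `a[u] = ∫ |ξ|^(2s) |F u (ξ)|² dξ`. -/
def fracForm {n : ℕ} (s : ℝ) (v u : L2 n) : ℂ :=
  ∫ ξ : E n, ((‖ξ‖ ^ (2 * s) : ℝ) : ℂ) * (conj (fourierN v ξ) * fourierN u ξ)

theorem fracForm_integrable {n : ℕ} {s : ℝ} {v u : L2 n} (hv : MemHs s v) (hu : MemHs s u) :
    Integrable
      (fun ξ : E n => ((‖ξ‖ ^ (2 * s) : ℝ) : ℂ) * (conj (fourierN v ξ) * fourierN u ξ)) := by
  have h : Integrable (fun ξ : E n => conj (((‖ξ‖ ^ s : ℝ) : ℂ) * fourierN v ξ) *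
      (((‖ξ‖ ^ s : ℝ) : ℂ) * fourierN u ξ)) := MemLp.integrable_mul (MemLp.star hv) hu
  refine h.congr (Eventually.of_forall fun ξ => ?_)
  have e : (‖ξ‖ ^ (2 * s) : ℝ) = ‖ξ‖ ^ s * ‖ξ‖ ^ s := by
    rw [mul_comm, Real.rpow_mul (norm_nonneg ξ), Real.rpow_two, sq]
  simp only [e, map_mul, Complex.conj_ofReal, Complex.ofReal_mul]
  ring

theorem fracForm_add {n : ℕ} {s : ℝ} {v u w : L2 n} (hv : MemHs s v) (hu : MemHs s u)
    (hw : MemHs s w) : fracForm s v (u + w) = fracForm s v u + fracForm s v w := by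
  unfold fracForm
  rw [← integral_add (fracForm_integrable hv hu) (fracForm_integrable hv hw)]
  refine integral_congr_ae ?_
  filter_upwards [fourierN_add u w] with ξ hξ
  simp only [hξ]
  ring

theorem fracForm_smul {n : ℕ} {s : ℝ} (c : ℂ) (v u : L2 n) :
    fracForm s v (c • u) = c * fracForm s v u := by
  unfold fracForm
  rw [← integral_const_mul]
  refine integral_congr_ae ?_
  filter_upwards [fourierN_smul c u] with ξ hξ
  simp only [hξ]
  ring

/-- The Hilbert space in which the closed form `a` with domain `H̃ˢ(Ω)` is densely defined: the
closure of `H̃ˢ(Ω)` in `L₂(ℝⁿ)`. For an open set `Ω` whose boundary has measure zero this is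
`L₂(Ω)`, regarded (extension by zero) as a subspace of `L₂(ℝⁿ)`. -/
abbrev formHilbert {n : ℕ} (s : ℝ) (Ω : Set (E n)) : Type :=
  (formDomain s Ω).topologicalClosure

/-- The pairs `(u, f)` with `u ∈ H̃ˢ(Ω)` and `a[v, u] = (v, f)` for all `v ∈ H̃ˢ(Ω)`. -/
def opGraph {n : ℕ} (s : ℝ) (Ω : Set (E n)) :
    Submodule ℂ (formHilbert s Ω × formHilbert s Ω) where
  carrier := {p | (p.1 : L2 n) ∈ formDomain s Ω ∧
    ∀ v ∈ formDomain s Ω, fracForm s v (p.1 : L2 n) = inner ℂ v (p.2 : L2 n)}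
  add_mem' := by
    rintro p q ⟨hp, hp'⟩ ⟨hq, hq'⟩
    refine ⟨(formDomain s Ω).add_mem hp hq, fun v hv => ?_⟩
    simp only [Prod.fst_add, Prod.snd_add, Submodule.coe_add]
    rw [fracForm_add hv.1 hp.1 hq.1, hp' v hv, hq' v hv, inner_add_right]
  zero_mem' := by
    refine ⟨(formDomain s Ω).zero_mem, fun v _ => ?_⟩
    have h := fracForm_smul (s := s) (0 : ℂ) v (0 : L2 n)
    rw [zero_smul, zero_mul] at h
    simpa using h
  smul_mem' := by
    rintro c p ⟨hp, hp'⟩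
    refine ⟨(formDomain s Ω).smul_mem c hp, fun v hv => ?_⟩
    simp only [Prod.smul_fst, Prod.smul_snd, Submodule.coe_smul]
    rw [fracForm_smul, hp' v hv, inner_smul_right]

/-- `opGraph s Ω` is the graph of an operator, since `H̃ˢ(Ω)` is dense in `formHilbert s Ω`. -/
theorem opGraph_single_valued {n : ℕ} (s : ℝ) (Ω : Set (E n)) :
    ∀ p : formHilbert s Ω × formHilbert s Ω, p ∈ opGraph s Ω → p.1 = 0 → p.2 = 0 := by
  rintro ⟨u, f⟩ ⟨_, h⟩ hu
  simp only at hu h ⊢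
  subst hu
  have h0 : ∀ v ∈ formDomain s Ω, inner ℂ v (f : L2 n) = 0 := by
    intro v hv
    rw [← h v hv]
    have h1 := fracForm_smul (s := s) (0 : ℂ) v (0 : L2 n)
    rw [zero_smul, zero_mul] at h1
    simpa using h1
  have h1 : (f : L2 n) ∈ (formDomain s Ω)ᗮ := (Submodule.mem_orthogonal _ _).2 h0
  rw [← Submodule.orthogonal_closure] at h1
  have h2 := (Submodule.mem_orthogonal _ _).1 h1 f f.2
  exact Subtype.ext (by simpa using h2)

/-- The restricted Dirichlet fractional Laplacian of order `s` in `Ω`: the (unbounded) operator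
associated with the form `a` on `H̃ˢ(Ω)`. Thus `u ∈ Dom` and `A u = f` if and only if
`u ∈ H̃ˢ(Ω)` and `a[v, u] = (v, f)` for all `v ∈ H̃ˢ(Ω)`. -/
def fracLaplacian {n : ℕ} (s : ℝ) (Ω : Set (E n)) :
    formHilbert s Ω →ₗ.[ℂ] formHilbert s Ω :=
  (opGraph s Ω).toLinearPMap

theorem fracLaplacian_graph {n : ℕ} (s : ℝ) (Ω : Set (E n)) :
    (fracLaplacian s Ω).graph = opGraph s Ω :=
  Submodule.toLinearPMap_graph_eq _ (opGraph_single_valued s Ω)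

/-! ### Spectra of unbounded operators -/

section Spectrum

variable {H : Type*} [NormedAddCommGroup H] [InnerProductSpace ℂ H]

/-- `z` is in the resolvent set of `A`: the operator `A - z : Dom A → H` has a bounded everywhere
defined two-sided inverse. -/
def IsRegularValue (A : H →ₗ.[ℂ] H) (z : ℂ) : Prop :=
  ∃ R : H →L[ℂ] H,
    (∀ f : H, ∃ h : R f ∈ A.domain, A ⟨R f, h⟩ - z • R f = f) ∧
    ∀ u : A.domain, R (A u - z • (u : H)) = u

/-- The spectrum of an unbounded operator. -/
def opSpectrum (A : H →ₗ.[ℂ] H) : Set ℂ := {z | ¬ IsRegularValue A z}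

/-- `z` is an eigenvalue of `A`. -/
def IsEigenvalue (A : H →ₗ.[ℂ] H) (z : ℂ) : Prop :=
  ∃ u : A.domain, (u : H) ≠ 0 ∧ A u = z • (u : H)

/-- The essential spectrum of a self-adjoint operator: all `z` that admit a Weyl sequence, i.e. an
orthonormal sequence `u k` in `Dom A` with `‖A u k - z u k‖ → 0`. -/
def essSpectrum (A : H →ₗ.[ℂ] H) : Set ℂ :=
  {z | ∃ u : ℕ → A.domain, Orthonormal ℂ (fun k => (u k : H)) ∧
    Tendsto (fun k => ‖A (u k) - z • (u k : H)‖) atTop (𝓝 0)}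

end Spectrum

/-- The straight tube `ω × ℝ ⊂ ℝ^(d+1)`, `x = (x', z)` with `x' ∈ ω` the first `d` coordinates. -/
def tube {d : ℕ} (ω : Set (E d)) : Set (E (d + 1)) :=
  {x | WithLp.toLp 2 (fun i : Fin d => x i.castSucc) ∈ ω}

end FracTube

end

/-!
The form of the fractional Laplacian on `ω × ℝ` decomposes into fibres. After a Fourier transform
`𝓕` in all variables the symbol is `((2π)² (‖η‖² + ζ²))ˢ`, where `ζ` is the frequency along the
tube. For almost every `ζ` the slice `𝓕 u (·, ζ)` of a function `u` in the form domain of the tube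
is the Fourier transform of a function in `H̃ˢ(ω)` (`ae_exists_slice_formDomain`). So the operator is
assembled from the operators on `ω` with symbol `((2π)² (‖η‖² + t²))ˢ`, one for each frequency `t`.

Let `groundEnergy hs t ω` be the infimum of the fibre form at `t` over the unit sphere of `L₂`.

* It is attained, by compactness of the embedding `H̃ˢ(ω) ⊂ L₂` for bounded `ω`
  (`exists_groundState`). At `t = 0` this gives the smallest eigenvalue `Λ` of the operator on `ω`
  (`isLeast_isEigenvalue`).
* Since the symbols increase with `t²`, the form on the tube is at least `Λ ‖u‖²`
  (`groundEnergy_mul_le_tube`). The spectrum is then contained in `[Λ, ∞)`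
  (`opSpectrum_fracLaplacian_subset`): with `J` the embedding of the form domain, `J J*` is
  `(A + 1)⁻¹`, a positive operator of norm at most `(1 + Λ)⁻¹`.
* Subadditivity of `x ↦ xˢ` bounds the difference of the symbols at `t` and `t'` by
  `((2π)² |t² - t'²|)ˢ`, uniformly in `η`. Hence the ground energy is continuous in `t`, and as it
  tends to infinity it attains every value in `[Λ, ∞)` (`exists_groundEnergy_eq`).
* If `φ` is a ground state at `t`, and `h` is a unit vector of `L₂(ℝ)` supported near `t`, then the
  function with Fourier transform `𝓕 φ ⊗ h` lies in the domain of the operator on the tube and is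
  an approximate eigenfunction, again by the uniform bound on the difference of symbols
  (`exists_approx_eigenvector`). Taking for `h` functions with disjoint supports yields a Weyl
  sequence, so every ground energy is in the essential spectrum.

Slices and products are handled by one fact about `L₂`, the identity `𝓕 (g ⊗ χ) = 𝓕 g ⊗ 𝓕 χ`
(`fourier_tensor`); the statement on slices follows from it by duality.
-/

noncomputable section

namespace FracTube

/-! ### The symbol and the Fourier transform -/

/-- The square root of the symbol `((2π)² (‖η‖² + t²))^s`. For `t = 0` this is `‖2πη‖^s`, the
multiplier of the fractional Laplacian in Mathlib's normalization of `𝓕`; for a general `t` it is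
the multiplier of the `(d+1)`-dimensional operator on the frequencies whose last coordinate is
`t`. -/
def rootSymb (s t : ℝ) {n : ℕ} (η : E n) : ℝ :=
  ((2 * Real.pi) ^ 2 * (‖η‖ ^ 2 + t ^ 2)) ^ (s / 2)

theorem rootSymb_nonneg (s t : ℝ) {n : ℕ} (η : E n) : 0 ≤ rootSymb s t η := by
  unfold rootSymb; positivity

theorem continuous_rootSymb {s : ℝ} (hs : 0 < s) (t : ℝ) {n : ℕ} :
    Continuous (rootSymb s t : E n → ℝ) := by
  unfold rootSymb
  exact Continuous.rpow_const (by fun_prop) fun _ => Or.inr (by positivity)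

theorem rootSymb_sq (s t : ℝ) {n : ℕ} (η : E n) :
    rootSymb s t η ^ 2 = ((2 * Real.pi) ^ 2 * (‖η‖ ^ 2 + t ^ 2)) ^ s := by
  unfold rootSymb
  rw [← Real.rpow_natCast, ← Real.rpow_mul (by positivity)]
  norm_num

theorem rootSymb_zero (s : ℝ) {n : ℕ} (η : E n) :
    rootSymb s 0 η = (2 * Real.pi * ‖η‖) ^ s := by
  unfold rootSymb
  rw [show (2 * Real.pi) ^ 2 * (‖η‖ ^ 2 + 0 ^ 2) = (2 * Real.pi * ‖η‖) ^ (2 : ℝ) by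
    rw [Real.rpow_two]; ring, ← Real.rpow_mul (by positivity)]
  congr 1; ring

theorem rootSymb_mono {s : ℝ} (hs : 0 < s) {t t' : ℝ} (h : t ^ 2 ≤ t' ^ 2) {n : ℕ} (η : E n) :
    rootSymb s t η ≤ rootSymb s t' η := by
  unfold rootSymb
  gcongr

/-- Subadditivity of `x ↦ x^p` for `p ≤ 1`, in the form of a modulus of continuity. -/
theorem abs_rpow_sub_rpow_le {p : ℝ} (hp0 : 0 ≤ p) (hp1 : p ≤ 1) {a b : ℝ} (ha : 0 ≤ a)
    (hb : 0 ≤ b) : |a ^ p - b ^ p| ≤ |a - b| ^ p := by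
  wlog h : b ≤ a generalizing a b
  · rw [abs_sub_comm, abs_sub_comm a b]
    exact this hb ha (le_of_not_ge h)
  have h1 : b ^ p ≤ a ^ p := Real.rpow_le_rpow hb h hp0
  have h2 := Real.rpow_add_le_add_rpow (sub_nonneg.2 h) hb hp0 hp1
  rw [sub_add_cancel] at h2
  rw [abs_of_nonneg (sub_nonneg.2 h1), abs_of_nonneg (sub_nonneg.2 h)]
  linarith

theorem abs_rootSymb_sq_sub_le {s : ℝ} (hs : s ∈ Ioo (0 : ℝ) 1) (t t' : ℝ) {n : ℕ} (η : E n) :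
    |rootSymb s t η ^ 2 - rootSymb s t' η ^ 2| ≤ ((2 * Real.pi) ^ 2 * |t ^ 2 - t' ^ 2|) ^ s := by
  rw [rootSymb_sq, rootSymb_sq]
  refine (abs_rpow_sub_rpow_le hs.1.le hs.2.le (by positivity) (by positivity)).trans_eq ?_
  rw [← mul_sub, abs_mul, abs_of_nonneg (by positivity : (0 : ℝ) ≤ (2 * Real.pi) ^ 2)]
  congr 3; ring

theorem rootSymb_le {s : ℝ} (hs : s ∈ Ioo (0 : ℝ) 1) (t : ℝ) {n : ℕ} (η : E n) :
    rootSymb s t η ≤ rootSymb s 0 η + ((2 * Real.pi) ^ 2 * t ^ 2) ^ (s / 2) := by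
  unfold rootSymb
  rw [mul_add]
  refine (Real.rpow_add_le_add_rpow (by positivity) (by positivity) (by linarith [hs.1])
    (by linarith [hs.2])).trans_eq ?_
  simp

theorem memLp_comp_smul_iff {n : ℕ} {c : ℝ} (hc : c ≠ 0) {f : E n → ℂ} :
    MemLp (fun ξ => f (c • ξ)) 2 volume ↔ MemLp f 2 volume := by
  have key : ∀ {c : ℝ}, c ≠ 0 → ∀ {f : E n → ℂ}, MemLp f 2 volume →
      MemLp (fun ξ => f (c • ξ)) 2 volume := by
    intro c hc f hf
    have h1 : MemLp f 2 (Measure.map (fun ξ : E n => c • ξ) volume) := by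
      rw [Measure.map_addHaar_smul volume hc]
      exact hf.smul_measure ENNReal.ofReal_ne_top
    exact h1.comp_of_map (by fun_prop)
  refine ⟨fun h => ?_, key hc⟩
  have := key (inv_ne_zero hc) h
  simpa [smul_smul, mul_inv_cancel₀ hc] using this

theorem rootSymb_scale (s : ℝ) {n : ℕ} (ξ : E n) :
    rootSymb s 0 ((2 * Real.pi)⁻¹ • ξ) = ‖ξ‖ ^ s := by
  have hpi : (0 : ℝ) < 2 * Real.pi := by positivity
  rw [rootSymb_zero, norm_smul, Real.norm_of_nonneg (by positivity), ← mul_assoc,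
    mul_inv_cancel₀ hpi.ne', one_mul]

theorem memHs_iff {n : ℕ} {s : ℝ} {u : L2 n} :
    MemHs s u ↔ MemLp (fun η : E n => (rootSymb s 0 η : ℂ) * (𝓕 u : L2 n) η) 2 volume := by
  have hpi : (0 : ℝ) < 2 * Real.pi := by positivity
  have hc : (((2 * Real.pi) ^ (-(n : ℝ) / 2) : ℝ) : ℂ) ≠ 0 :=
    Complex.ofReal_ne_zero.2 (by positivity)
  rw [← memLp_comp_smul_iff (inv_ne_zero hpi.ne')]
  unfold MemHs fourierN
  constructor
  · intro h
    refine (h.const_mul (((2 * Real.pi) ^ (-(n : ℝ) / 2) : ℝ) : ℂ)⁻¹).ae_eq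
      (Eventually.of_forall fun ξ => ?_)
    simp only [rootSymb_scale]
    rw [mul_left_comm, inv_mul_cancel_left₀ hc]
  · intro h
    refine (h.const_mul (((2 * Real.pi) ^ (-(n : ℝ) / 2) : ℝ) : ℂ)).ae_eq
      (Eventually.of_forall fun ξ => ?_)
    simp only [rootSymb_scale]
    ring

/-- The space `Hˢ` does not depend on the frequency `t`, as the multipliers for different `t` differ
by a bounded function. -/
theorem memHs_iff_rootSymb {n : ℕ} {s : ℝ} (hs : s ∈ Ioo (0 : ℝ) 1) (t : ℝ) {u : L2 n} :
    MemHs s u ↔ MemLp (fun η : E n => (rootSymb s t η : ℂ) * (𝓕 u : L2 n) η) 2 volume := by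
  have hm (t : ℝ) : AEStronglyMeasurable
      (fun η : E n => (rootSymb s t η : ℂ) * (𝓕 u : L2 n) η) volume :=
    (Complex.continuous_ofReal.comp (continuous_rootSymb hs.1 t)).aestronglyMeasurable.mul
      (Lp.aestronglyMeasurable _)
  rw [memHs_iff]
  refine ⟨fun h => ?_, fun h => ?_⟩
  · refine (h.norm.add ((Lp.memLp (𝓕 u : L2 n)).norm.const_mul
      (((2 * Real.pi) ^ 2 * t ^ 2) ^ (s / 2)))).of_le (hm t) (Eventually.of_forall fun η => ?_)
    simp only [Pi.add_apply, norm_mul, Complex.norm_real,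
      Real.norm_of_nonneg (rootSymb_nonneg _ _ _)]
    rw [← add_mul, norm_mul, norm_norm]
    gcongr
    exact (rootSymb_le hs t η).trans (le_abs_self _)
  · refine h.of_le (hm 0) (Eventually.of_forall fun η => ?_)
    simp only [norm_mul, Complex.norm_real, Real.norm_of_nonneg (rootSymb_nonneg _ _ _)]
    gcongr
    exact rootSymb_mono hs.1 (by simpa using sq_nonneg t) η

/-- The form in terms of Mathlib's `𝓕`: the normalizing factor `(2π)^(-n)` cancels against the
Jacobian of `ξ = 2π η`. -/
theorem fracForm_eq {n : ℕ} (s : ℝ) (v u : L2 n) :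
    fracForm s v u = ∫ η : E n, conj ((rootSymb s 0 η : ℂ) * (𝓕 v : L2 n) η) *
      ((rootSymb s 0 η : ℂ) * (𝓕 u : L2 n) η) := by
  have hpi : (0 : ℝ) < 2 * Real.pi := by positivity
  set c : ℝ := (2 * Real.pi) ^ (-(n : ℝ) / 2) with hc
  have h1 : fracForm s v u = ∫ ξ : E n, ((c ^ 2 : ℝ) : ℂ) *
      (conj ((rootSymb s 0 ((2 * Real.pi)⁻¹ • ξ) : ℂ) * (𝓕 v : L2 n) ((2 * Real.pi)⁻¹ • ξ)) *
      ((rootSymb s 0 ((2 * Real.pi)⁻¹ • ξ) : ℂ) * (𝓕 u : L2 n) ((2 * Real.pi)⁻¹ • ξ))) := by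
    unfold fracForm fourierN
    refine integral_congr_ae (Eventually.of_forall fun ξ => ?_)
    have e : (‖ξ‖ ^ (2 * s) : ℝ) = ‖ξ‖ ^ s * ‖ξ‖ ^ s := by
      rw [mul_comm, Real.rpow_mul (norm_nonneg ξ), Real.rpow_two, sq]
    simp only [rootSymb_scale, e, ← hc, map_mul, Complex.conj_ofReal, Complex.ofReal_mul,
      Complex.ofReal_pow]
    ring
  rw [h1, integral_const_mul, Measure.integral_comp_smul volume (fun η : E n =>
    conj ((rootSymb s 0 η : ℂ) * (𝓕 v : L2 n) η) * ((rootSymb s 0 η : ℂ) * (𝓕 u : L2 n) η)),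
    finrank_euclideanSpace_fin, Complex.real_smul, ← mul_assoc]
  have h2 : c ^ 2 * |(((2 * Real.pi)⁻¹) ^ n)⁻¹| = 1 := by
    rw [abs_of_pos (by positivity), inv_pow, inv_inv, hc, ← Real.rpow_natCast, ← Real.rpow_mul
      hpi.le, ← Real.rpow_natCast, ← Real.rpow_add hpi]
    simp
  rw [← Complex.ofReal_mul, h2, Complex.ofReal_one, one_mul]

/-- The linear map `u ↦ ((2π)² (‖η‖² + t²))^(s/2) 𝓕 u` from `H̃ˢ(Ω)` to `L₂`; the square of its
norm is the quadratic form of the fractional Laplacian, for `t = 0`, or of its fibre at the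
frequency `t` in the direction of the tube. -/
def symbMul {n : ℕ} {s : ℝ} (hs : s ∈ Ioo (0 : ℝ) 1) (t : ℝ) (Ω : Set (E n)) :
    formDomain s Ω →ₗ[ℂ] L2 n where
  toFun u := ((memHs_iff_rootSymb hs t).1 u.2.1).toLp _
  map_add' u v := by
    rw [← MemLp.toLp_add]
    refine MemLp.toLp_congr _ _ ?_
    have h := Lp.coeFn_add (𝓕 (u : L2 n) : L2 n) (𝓕 (v : L2 n) : L2 n)
    rw [← FourierTransform.fourier_add] at h
    filter_upwards [h] with η hη
    simp only [Submodule.coe_add, Pi.add_apply, hη, mul_add]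
  map_smul' c u := by
    rw [RingHom.id_apply, ← MemLp.toLp_const_smul]
    refine MemLp.toLp_congr _ _ ?_
    have h := Lp.coeFn_smul c (𝓕 (u : L2 n) : L2 n)
    rw [← FourierTransform.fourier_smul] at h
    filter_upwards [h] with η hη
    simp only [Submodule.coe_smul, Pi.smul_apply, hη, smul_eq_mul]
    ring

theorem coeFn_symbMul {n : ℕ} {s : ℝ} (hs : s ∈ Ioo (0 : ℝ) 1) (t : ℝ) {Ω : Set (E n)}
    (u : formDomain s Ω) :
    symbMul hs t Ω u =ᵐ[volume] fun η => (rootSymb s t η : ℂ) * (𝓕 (u : L2 n) : L2 n) η :=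
  MemLp.coeFn_toLp ((memHs_iff_rootSymb hs t).1 u.2.1)

theorem fracForm_eq_inner {n : ℕ} {s : ℝ} (hs : s ∈ Ioo (0 : ℝ) 1) {Ω : Set (E n)}
    (v u : formDomain s Ω) :
    fracForm s (v : L2 n) (u : L2 n) = inner ℂ (symbMul hs 0 Ω v) (symbMul hs 0 Ω u) := by
  rw [fracForm_eq, L2.inner_def]
  refine integral_congr_ae ?_
  filter_upwards [coeFn_symbMul hs 0 v, coeFn_symbMul hs 0 u] with η h1 h2
  rw [h1, h2, RCLike.inner_apply, mul_comm]

/-- The `L₂` Fourier transform of an integrable function is given by the Fourier integral. -/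
theorem coeFn_fourier_ae_eq {V : Type*} [NormedAddCommGroup V] [InnerProductSpace ℝ V]
    [FiniteDimensional ℝ V] [MeasurableSpace V] [BorelSpace V]
    (f : Lp ℂ 2 (volume : Measure V)) (hf : Integrable f volume) :
    ((𝓕 f : Lp ℂ 2 (volume : Measure V)) : V → ℂ) =ᵐ[volume] 𝓕 (f : V → ℂ) := by
  have hcont : Continuous (𝓕 (f : V → ℂ)) :=
    VectorFourier.fourierIntegral_continuous Real.continuous_fourierChar
      (by exact continuous_inner) hf
  refine ae_eq_of_integral_contDiff_smul_eq
    ((Lp.memLp (𝓕 f : Lp ℂ 2 (volume : Measure V))).locallyIntegrable (by norm_num))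
    hcont.locallyIntegrable fun g hg hgs => ?_
  have hg1 : ContDiff ℝ (⊤ : ℕ∞) (fun x => (g x : ℂ)) := Complex.ofRealCLM.contDiff.comp hg
  have hg2 : HasCompactSupport (fun x => (g x : ℂ)) :=
    hgs.comp_left (g := fun r : ℝ => (r : ℂ)) Complex.ofReal_zero
  set G := hg2.toSchwartzMap hg1 with hG
  have hGx : ∀ x, G x = (g x : ℂ) := fun x => rfl
  have h1 := congrArg (fun T => T G) (Lp.fourier_toTemperedDistribution_eq f)
  simp only [TemperedDistribution.fourier_apply, Lp.toTemperedDistribution_apply] at h1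
  have h2 := VectorFourier.integral_fourierIntegral_smul_eq_flip (L := innerₗ V) (μ := volume)
    (ν := volume) Real.continuous_fourierChar (by exact continuous_inner) hf
    (G.integrable (μ := volume))
  have h3 : VectorFourier.fourierIntegral Real.fourierChar volume (innerₗ V).flip (G : V → ℂ) =
      ⇑(𝓕 G : SchwartzMap V ℂ) := by
    rw [flip_innerₗ]; rfl
  rw [h3] at h2
  have h4 : ∫ x, (𝓕 G : SchwartzMap V ℂ) x • f x = ∫ x, f x • (𝓕 G : SchwartzMap V ℂ) x :=
    integral_congr_ae (Eventually.of_forall fun x => by simp only [smul_eq_mul, mul_comm])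
  calc ∫ x, g x • (𝓕 f : Lp ℂ 2 (volume : Measure V)) x
      = ∫ x, G x • (𝓕 f : Lp ℂ 2 (volume : Measure V)) x := by simp [hGx]
    _ = ∫ x, f x • (𝓕 G : SchwartzMap V ℂ) x := by rw [← h1, h4]
    _ = ∫ x, g x • 𝓕 (f : V → ℂ) x := by
      rw [← h2]
      refine integral_congr_ae (Eventually.of_forall fun x => ?_)
      simp only [hGx, smul_eq_mul, Complex.real_smul, mul_comm]
      rfl

/-! ### Splitting off the last coordinate -/

/-- The identification `(x', z) ↦ x` of `ℝᵈ × ℝ` with `ℝ^(d+1)`. -/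
def joinEquiv (d : ℕ) : E d × ℝ ≃ᵐ E (d + 1) :=
  ((MeasurableEquiv.toLp 2 (Fin d → ℝ)).symm.prodCongr (MeasurableEquiv.refl ℝ)).trans
    ((MeasurableEquiv.prodComm).trans
      ((MeasurableEquiv.piFinSuccAbove (fun _ => ℝ) (Fin.last d)).symm.trans
        (MeasurableEquiv.toLp 2 (Fin (d + 1) → ℝ))))

theorem measurePreserving_joinEquiv (d : ℕ) :
    MeasurePreserving (joinEquiv d) volume volume := by
  unfold joinEquiv
  refine (MeasurePreserving.prod
    (EuclideanSpace.volume_preserving_symm_measurableEquiv_toLp (Fin d))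
    (MeasurePreserving.id (volume : Measure ℝ))).trans ?_
  refine (Measure.measurePreserving_swap).trans ?_
  refine ((volume_preserving_piFinSuccAbove (fun _ => ℝ) (Fin.last d)).symm _).trans ?_
  exact (EuclideanSpace.volume_preserving_symm_measurableEquiv_toLp (Fin (d + 1))).symm _

@[simp] theorem joinEquiv_castSucc {d : ℕ} (p : E d × ℝ) (i : Fin d) :
    joinEquiv d p i.castSucc = p.1 i := by
  have : joinEquiv d p = WithLp.toLp 2 ((Fin.last d).insertNth p.2 (WithLp.ofLp p.1)) := rfl
  rw [this, ← Fin.succAbove_last]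
  simp

@[simp] theorem joinEquiv_last {d : ℕ} (p : E d × ℝ) : joinEquiv d p (Fin.last d) = p.2 := by
  have : joinEquiv d p = WithLp.toLp 2 ((Fin.last d).insertNth p.2 (WithLp.ofLp p.1)) := rfl
  rw [this]
  simp

theorem inner_joinEquiv {d : ℕ} (p q : E d × ℝ) :
    inner ℝ (joinEquiv d p) (joinEquiv d q) = inner ℝ p.1 q.1 + inner ℝ p.2 q.2 := by
  simp [PiLp.inner_apply, Fin.sum_univ_castSucc]

theorem norm_sq_joinEquiv {d : ℕ} (p : E d × ℝ) :
    ‖joinEquiv d p‖ ^ 2 = ‖p.1‖ ^ 2 + p.2 ^ 2 := by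
  rw [← real_inner_self_eq_norm_sq, ← real_inner_self_eq_norm_sq, inner_joinEquiv]
  simp [sq]

theorem rootSymb_joinEquiv {d : ℕ} (s : ℝ) (p : E d × ℝ) :
    rootSymb s 0 (joinEquiv d p) = rootSymb s p.2 p.1 := by
  unfold rootSymb
  rw [norm_sq_joinEquiv]
  simp

theorem joinEquiv_mem_closure_tube {d : ℕ} {ω : Set (E d)} (p : E d × ℝ) :
    joinEquiv d p ∈ closure (tube ω) ↔ p.1 ∈ closure ω := by
  let π : E (d + 1) →ₗ[ℝ] E d :=
    { toFun := fun x => WithLp.toLp 2 (fun i : Fin d => x i.castSucc)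
      map_add' := fun x y => rfl
      map_smul' := fun c x => rfl }
  have hπ (p : E d × ℝ) : π (joinEquiv d p) = p.1 := by
    ext i
    exact joinEquiv_castSucc p i
  have hsurj : Function.Surjective π := fun x => ⟨joinEquiv d (x, 0), hπ _⟩
  have hcl := (π.isOpenMap_of_finiteDimensional hsurj).preimage_closure_eq_closure_preimage
    π.continuous_of_finiteDimensional ω
  have ht : tube ω = π ⁻¹' ω := rfl
  rw [ht, ← hcl, mem_preimage, hπ]

theorem ae_joinEquiv {d : ℕ} {P : E (d + 1) → Prop} (h : ∀ᵐ x, P x) :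
    ∀ᵐ p : E d × ℝ, P (joinEquiv d p) :=
  (measurePreserving_joinEquiv d).quasiMeasurePreserving.ae h

theorem ae_of_ae_joinEquiv {d : ℕ} {P : E (d + 1) → Prop}
    (h : ∀ᵐ p : E d × ℝ, P (joinEquiv d p)) : ∀ᵐ x, P x := by
  have := ((measurePreserving_joinEquiv d).symm _).quasiMeasurePreserving.ae h
  simpa using this

theorem memLp_joinEquiv {d : ℕ} {f : E (d + 1) → ℂ} :
    MemLp (fun p => f (joinEquiv d p)) 2 volume ↔ MemLp f 2 volume := by
  rw [← (measurePreserving_joinEquiv d).map_eq]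
  exact ((joinEquiv d).memLp_map_measure_iff).symm

theorem integrable_joinEquiv {d : ℕ} {f : E (d + 1) → ℂ} :
    Integrable (fun p => f (joinEquiv d p)) volume ↔ Integrable f volume :=
  (measurePreserving_joinEquiv d).integrable_comp_emb (joinEquiv d).measurableEmbedding

theorem integral_joinEquiv {d : ℕ} {F : Type*} [NormedAddCommGroup F] [NormedSpace ℝ F]
    (f : E (d + 1) → F) :
    ∫ p, f (joinEquiv d p) = ∫ x, f x :=
  (measurePreserving_joinEquiv d).integral_comp' f

/-! ### Tensor products -/

/-- The Hilbert space `L₂(ℝ)`. -/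
abbrev L2R : Type := Lp ℂ 2 (volume : Measure ℝ)

theorem memLp_mul_prod {d : ℕ} {g : E d → ℂ} {χ : ℝ → ℂ} (hg : MemLp g 2 volume)
    (hχ : MemLp χ 2 volume) : MemLp (fun p : E d × ℝ => g p.1 * χ p.2) 2 volume := by
  rw [memLp_two_iff_integrable_sq_norm]
  · have h1 := (memLp_two_iff_integrable_sq_norm hg.1).1 hg
    have h2 := (memLp_two_iff_integrable_sq_norm hχ.1).1 hχ
    refine (h1.mul_prod h2).congr (Eventually.of_forall fun p => ?_)
    simp only [norm_mul, mul_pow]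
  · exact (hg.1.comp_fst).mul (hχ.1.comp_snd)

theorem memLp_tensor {d : ℕ} (g : L2 d) (χ : L2R) :
    MemLp (fun x => g ((joinEquiv d).symm x).1 * χ ((joinEquiv d).symm x).2) 2 volume := by
  rw [← memLp_joinEquiv]
  simpa using memLp_mul_prod (Lp.memLp g) (Lp.memLp χ)

/-- The function `(x', z) ↦ g x' * χ z`, as an element of `L₂(ℝ^(d+1))`. -/
def tensor {d : ℕ} (g : L2 d) (χ : L2R) : L2 (d + 1) := (memLp_tensor g χ).toLp _

theorem coeFn_tensor {d : ℕ} (g : L2 d) (χ : L2R) :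
    ∀ᵐ p : E d × ℝ, tensor g χ (joinEquiv d p) = g p.1 * χ p.2 := by
  filter_upwards [ae_joinEquiv (MemLp.coeFn_toLp (memLp_tensor g χ))] with p hp
  rw [tensor, hp]
  simp

theorem ae_fst {d : ℕ} {P : E d → Prop} (h : ∀ᵐ x, P x) : ∀ᵐ p : E d × ℝ, P p.1 :=
  Measure.quasiMeasurePreserving_fst.ae h

theorem ae_snd {d : ℕ} {P : ℝ → Prop} (h : ∀ᵐ z, P z) : ∀ᵐ p : E d × ℝ, P p.2 :=
  Measure.quasiMeasurePreserving_snd.ae h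

theorem ext_joinEquiv {d : ℕ} {u v : L2 (d + 1)}
    (h : ∀ᵐ p : E d × ℝ, u (joinEquiv d p) = v (joinEquiv d p)) : u = v :=
  Lp.ext (ae_of_ae_joinEquiv h)

theorem inner_eq_integral_joinEquiv {d : ℕ} (u v : L2 (d + 1)) :
    inner ℂ u v = ∫ p : E d × ℝ, conj (u (joinEquiv d p)) * v (joinEquiv d p) := by
  rw [L2.inner_def, ← integral_joinEquiv]
  simp only [RCLike.inner_apply, mul_comm]

theorem inner_tensor {d : ℕ} (g g' : L2 d) (χ χ' : L2R) :
    inner ℂ (tensor g χ) (tensor g' χ') = inner ℂ g g' * inner ℂ χ χ' := by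
  rw [inner_eq_integral_joinEquiv, L2.inner_def, L2.inner_def]
  simp only [RCLike.inner_apply]
  rw [← integral_prod_mul]
  refine integral_congr_ae ?_
  filter_upwards [coeFn_tensor g χ, coeFn_tensor g' χ'] with p h1 h2
  rw [h1, h2, map_mul]
  ring

theorem norm_tensor {d : ℕ} (g : L2 d) (χ : L2R) : ‖tensor g χ‖ = ‖g‖ * ‖χ‖ := by
  have h := inner_tensor g g χ χ
  simp only [inner_self_eq_norm_sq_to_K] at h
  have h' : ‖tensor g χ‖ ^ 2 = (‖g‖ * ‖χ‖) ^ 2 := by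
    rw [mul_pow]; exact_mod_cast h
  exact (pow_left_inj₀ (norm_nonneg _) (by positivity) two_ne_zero).1 h'

/-- The tensor product as a bounded bilinear map. -/
def tensorL (d : ℕ) : L2 d →L[ℂ] L2R →L[ℂ] L2 (d + 1) :=
  LinearMap.mkContinuous₂
    (LinearMap.mk₂ ℂ tensor
      (fun g g' χ => ext_joinEquiv <| by
        filter_upwards [coeFn_tensor (g + g') χ, coeFn_tensor g χ, coeFn_tensor g' χ,
          ae_joinEquiv (Lp.coeFn_add (tensor g χ) (tensor g' χ)), ae_fst (Lp.coeFn_add g g')]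
          with p h1 h2 h3 h4 h5
        rw [h1, h4, Pi.add_apply, h2, h3, h5, Pi.add_apply, add_mul])
      (fun c g χ => ext_joinEquiv <| by
        filter_upwards [coeFn_tensor (c • g) χ, coeFn_tensor g χ,
          ae_joinEquiv (Lp.coeFn_smul c (tensor g χ)), ae_fst (Lp.coeFn_smul c g)]
          with p h1 h2 h3 h4
        rw [h1, h3, Pi.smul_apply, h2, h4, Pi.smul_apply, smul_mul_assoc])
      (fun g χ χ' => ext_joinEquiv <| by
        filter_upwards [coeFn_tensor g (χ + χ'), coeFn_tensor g χ, coeFn_tensor g χ',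
          ae_joinEquiv (Lp.coeFn_add (tensor g χ) (tensor g χ')), ae_snd (Lp.coeFn_add χ χ')]
          with p h1 h2 h3 h4 h5
        rw [h1, h4, Pi.add_apply, h2, h3, h5, Pi.add_apply, mul_add])
      (fun c g χ => ext_joinEquiv <| by
        filter_upwards [coeFn_tensor g (c • χ), coeFn_tensor g χ,
          ae_joinEquiv (Lp.coeFn_smul c (tensor g χ)), ae_snd (Lp.coeFn_smul c χ)]
          with p h1 h2 h3 h4
        rw [h1, h3, Pi.smul_apply, h2, h4, Pi.smul_apply, mul_smul_comm]))
    1 (fun g χ => by rw [one_mul]; exact (norm_tensor g χ).le)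

theorem fourier_tensor_schwartz {d : ℕ} (G : SchwartzMap (E d) ℂ) (X : SchwartzMap ℝ ℂ) :
    (𝓕 (tensor (G.toLp 2) (X.toLp 2)) : L2 (d + 1)) =
      tensor (𝓕 (G.toLp 2) : L2 d) (𝓕 (X.toLp 2) : L2R) := by
  have hae (G : SchwartzMap (E d) ℂ) (X : SchwartzMap ℝ ℂ) :
      ∀ᵐ p : E d × ℝ, tensor (G.toLp 2) (X.toLp 2) (joinEquiv d p) = G p.1 * X p.2 := by
    filter_upwards [coeFn_tensor (G.toLp 2) (X.toLp 2), ae_fst (G.coeFn_toLp 2 volume),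
      ae_snd (X.coeFn_toLp 2 volume)] with p h1 h2 h3
    rw [h1, h2, h3]
  have hint : Integrable (tensor (G.toLp 2) (X.toLp 2)) volume := by
    rw [← integrable_joinEquiv]
    refine (G.integrable.mul_prod X.integrable).congr ?_
    filter_upwards [hae G X] with p hp
    exact hp.symm
  rw [SchwartzMap.toLp_fourier_eq, SchwartzMap.toLp_fourier_eq]
  refine ext_joinEquiv ?_
  filter_upwards [ae_joinEquiv (coeFn_fourier_ae_eq _ hint), hae (𝓕 G) (𝓕 X)] with q h1 h2
  rw [h1, h2, SchwartzMap.fourier_coe, SchwartzMap.fourier_coe, Real.fourier_eq',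
    Real.fourier_eq', Real.fourier_eq', ← integral_joinEquiv, ← integral_prod_mul]
  refine integral_congr_ae ?_
  filter_upwards [hae G X] with p hp
  rw [hp, inner_joinEquiv]
  simp only [smul_eq_mul, mul_add, Complex.ofReal_add, add_mul, Complex.exp_add]
  ring

/-- The Fourier transform respects tensor products. -/
theorem fourier_tensor {d : ℕ} (g : L2 d) (χ : L2R) :
    (𝓕 (tensor g χ) : L2 (d + 1)) = tensor (𝓕 g : L2 d) (𝓕 χ : L2R) := by
  have hg : DenseRange (fun G : SchwartzMap (E d) ℂ => G.toLp 2 (volume : Measure (E d))) :=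
    SchwartzMap.denseRange_toLpCLM (F := ℂ) (p := 2) (by norm_num)
  have hχ : DenseRange (fun X : SchwartzMap ℝ ℂ => X.toLp 2 (volume : Measure ℝ)) :=
    SchwartzMap.denseRange_toLpCLM (F := ℂ) (p := 2) (by norm_num)
  refine (hg.prodMap hχ).induction_on
    (p := fun q : L2 d × L2R => (𝓕 (tensor q.1 q.2) : L2 (d + 1)) = tensor (𝓕 q.1) (𝓕 q.2))
    (g, χ) ?_ fun q => fourier_tensor_schwartz q.1 q.2
  have hT : Continuous fun q : L2 d × L2R => tensorL d q.1 q.2 :=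
    (tensorL d).continuous₂
  have hF (n : ℕ) : Continuous fun u : L2 n => (𝓕 u : L2 n) :=
    (Lp.fourierTransformₗᵢ (E n) ℂ).continuous
  have hFR : Continuous fun u : L2R => (𝓕 u : L2R) :=
    (Lp.fourierTransformₗᵢ ℝ ℂ).continuous
  refine isClosed_eq ((hF _).comp hT) (hT.comp (((hF d).comp continuous_fst).prodMk
    (hFR.comp continuous_snd)))

/-! ### Slices of functions at a fixed last coordinate -/

theorem integrable_conj_mul {α : Type*} [MeasurableSpace α] {μ : Measure α} {f g : α → ℂ}
    (hf : MemLp f 2 μ) (hg : MemLp g 2 μ) : Integrable (fun x => conj (f x) * g x) μ :=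
  MemLp.integrable_mul (MemLp.star hf) hg

theorem inner_eq_integral {α : Type*} [MeasurableSpace α] {μ : Measure α} (f g : Lp ℂ 2 μ) :
    inner ℂ f g = ∫ x, conj (f x) * g x ∂μ := by
  rw [L2.inner_def]
  simp only [RCLike.inner_apply, mul_comm]

theorem norm_sq_eq_integral {α : Type*} [MeasurableSpace α] {μ : Measure α} (f : Lp ℂ 2 μ) :
    ‖f‖ ^ 2 = ∫ x, ‖f x‖ ^ 2 ∂μ := by
  have h : ((‖f‖ ^ 2 : ℝ) : ℂ) = ((∫ x, ‖f x‖ ^ 2 ∂μ : ℝ) : ℂ) := by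
    rw [← integral_complex_ofReal, Complex.ofReal_pow, ← Complex.coe_algebraMap,
      ← inner_self_eq_norm_sq_to_K (𝕜 := ℂ), inner_eq_integral]
    refine integral_congr_ae (Eventually.of_forall fun x => ?_)
    simp only [RCLike.conj_mul]
    norm_cast
  exact_mod_cast h

theorem memLp_joinEquiv_coeFn {d : ℕ} (u : L2 (d + 1)) :
    MemLp (fun p : E d × ℝ => u (joinEquiv d p)) 2 volume :=
  memLp_joinEquiv.2 (Lp.memLp u)

theorem ae_memLp_slice {d : ℕ} (u : L2 (d + 1)) :
    ∀ᵐ ζ : ℝ, MemLp (fun η : E d => u (joinEquiv d (η, ζ))) 2 volume := by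
  have h := memLp_joinEquiv_coeFn u
  have h2 := (memLp_two_iff_integrable_sq_norm h.1).1 h
  filter_upwards [h2.prod_left_ae, h.1.prodMk_right] with ζ h3 h4
  exact (memLp_two_iff_integrable_sq_norm h4).2 h3

theorem integrable_slice_sq {d : ℕ} (u : L2 (d + 1)) :
    Integrable (fun ζ : ℝ => ∫ η : E d, ‖u (joinEquiv d (η, ζ))‖ ^ 2) volume := by
  have h := memLp_joinEquiv_coeFn u
  exact ((memLp_two_iff_integrable_sq_norm h.1).1 h).integral_prod_right

theorem norm_sq_eq_integral_slice {d : ℕ} (u : L2 (d + 1)) :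
    ‖u‖ ^ 2 = ∫ ζ : ℝ, ∫ η : E d, ‖u (joinEquiv d (η, ζ))‖ ^ 2 := by
  have h := memLp_joinEquiv_coeFn u
  rw [norm_sq_eq_integral, ← integral_joinEquiv]
  exact integral_prod_symm _ ((memLp_two_iff_integrable_sq_norm h.1).1 h)

/-- Membership in `L₂` with vanishing off `K` is detected by testing against functions that vanish
on `K`. -/
theorem ae_eq_zero_of_inner_eq_zero {n : ℕ} {K : Set (E n)} (hK : MeasurableSet K) {w : L2 n}
    (h : ∀ g : L2 n, (∀ᵐ x, x ∈ K → g x = 0) → inner ℂ g w = 0) :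
    ∀ᵐ x, x ∉ K → w x = 0 := by
  have hm : MemLp (Kᶜ.indicator (w : E n → ℂ)) 2 volume := (Lp.memLp w).indicator hK.compl
  set g : L2 n := hm.toLp _
  have hg : g =ᵐ[volume] Kᶜ.indicator (w : E n → ℂ) := hm.coeFn_toLp
  have h1 : inner ℂ g g = 0 := by
    rw [← h g ?_, inner_eq_integral, inner_eq_integral]
    · refine integral_congr_ae ?_
      filter_upwards [hg] with x hx
      by_cases hxK : x ∈ K <;> simp [hx, hxK]
    · filter_upwards [hg] with x hx hxK
      simp [hx, hxK]
  rw [inner_self_eq_zero] at h1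
  rw [h1] at hg
  filter_upwards [hg, Lp.coeFn_zero ℂ 2 (volume : Measure (E n))] with x hx h0 hxK
  rw [h0] at hx
  simpa [hxK] using hx.symm

/-- If `u` vanishes off the cylinder `K × ℝ` and `g` vanishes on `K`, then almost every slice of
`𝓕 u` is orthogonal to `𝓕 g`: test with `g ⊗ χ`, where `𝓕 χ` is an indicator function. -/
theorem ae_integral_slice_eq_zero {d : ℕ} {K : Set (E d)} {u : L2 (d + 1)}
    (hu : ∀ᵐ p : E d × ℝ, p.1 ∉ K → u (joinEquiv d p) = 0) {g : L2 d}
    (hg : ∀ᵐ x, x ∈ K → g x = 0) :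
    ∀ᵐ ζ : ℝ, ∫ η : E d, conj ((𝓕 g : L2 d) η) * (𝓕 u : L2 (d + 1)) (joinEquiv d (η, ζ)) = 0 := by
  set h : ℝ → ℂ := fun ζ =>
    ∫ η : E d, conj ((𝓕 g : L2 d) η) * (𝓕 u : L2 (d + 1)) (joinEquiv d (η, ζ)) with hh
  have key (S : Set ℝ) (hS : MeasurableSet S) (hSf : volume S < ⊤) :
      IntegrableOn h S ∧ ∫ ζ in S, h ζ = 0 := by
    set χ : L2R := indicatorConstLp 2 hS hSf.ne 1
    have hχ : ∀ᵐ ζ : ℝ, χ ζ = S.indicator (fun _ => (1 : ℂ)) ζ := indicatorConstLp_coeFn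
    have hF : Integrable (fun p : E d × ℝ => conj ((𝓕 g : L2 d) p.1 * χ p.2) *
        (𝓕 u : L2 (d + 1)) (joinEquiv d p)) volume :=
      integrable_conj_mul (memLp_mul_prod (Lp.memLp _) (Lp.memLp _)) (memLp_joinEquiv_coeFn _)
    have hind : ∀ᵐ ζ : ℝ, ∫ η : E d, conj ((𝓕 g : L2 d) η * χ ζ) *
        (𝓕 u : L2 (d + 1)) (joinEquiv d (η, ζ)) = S.indicator h ζ := by
      filter_upwards [hχ] with ζ hζ
      rw [hζ]
      by_cases hζS : ζ ∈ S <;> simp [hζS, hh]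
    have hint : Integrable (S.indicator h) volume := hF.integral_prod_right.congr hind
    refine ⟨(integrable_indicator_iff hS).1 hint, ?_⟩
    rw [← integral_indicator hS, ← integral_congr_ae hind]
    have h1 : inner ℂ (tensor (𝓕 g : L2 d) χ) (𝓕 u : L2 (d + 1)) = 0 := by
      have h2 : χ = (𝓕 (𝓕⁻ χ : L2R) : L2R) := (FourierTransform.fourier_fourierInv_eq χ).symm
      rw [h2, ← fourier_tensor, Lp.inner_fourier_eq, inner_eq_integral_joinEquiv]
      refine integral_eq_zero_of_ae ?_
      filter_upwards [hu, ae_fst hg, coeFn_tensor g (𝓕⁻ χ : L2R)] with p h3 h4 h5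
      by_cases hp : p.1 ∈ K
      · simp [h5, h4 hp]
      · simp [h3 hp]
    rw [← h1, inner_eq_integral_joinEquiv]
    refine (integral_prod_symm _ hF).symm.trans (integral_congr_ae ?_)
    filter_upwards [coeFn_tensor (𝓕 g : L2 d) χ] with p hp
    rw [hp]
  exact ae_eq_zero_of_forall_setIntegral_eq_of_sigmaFinite (fun S hS hSf => (key S hS hSf).1)
    fun S hS hSf => (key S hS hSf).2

/-- If `u` vanishes off the cylinder `K × ℝ`, then almost every slice of `𝓕 u` is the Fourier
transform of a function that vanishes off `K`. -/
theorem ae_exists_slice {d : ℕ} {K : Set (E d)} (hK : MeasurableSet K) {u : L2 (d + 1)}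
    (hu : ∀ᵐ p : E d × ℝ, p.1 ∉ K → u (joinEquiv d p) = 0) :
    ∀ᵐ ζ : ℝ, ∃ w : L2 d, (∀ᵐ x, x ∉ K → w x = 0) ∧
      ∀ᵐ η : E d, (𝓕 w : L2 d) η = (𝓕 u : L2 (d + 1)) (joinEquiv d (η, ζ)) := by
  have hzero : ∀ᵐ x : E d, x ∈ K → (0 : L2 d) x = 0 := by
    filter_upwards [Lp.coeFn_zero ℂ 2 (volume : Measure (E d))] with x hx _
    exact hx
  -- countably many test functions suffice
  let N : Set (L2 d) := {g | ∀ᵐ x, x ∈ K → g x = 0}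
  have : Nonempty N := ⟨⟨0, hzero⟩⟩
  have : Fact ((2 : ENNReal) ≠ ⊤) := ⟨by norm_num⟩
  have : SecondCountableTopology (L2 d) := Lp.SecondCountableTopology
  have hall : ∀ᵐ ζ : ℝ, ∀ j : ℕ, ∫ η : E d,
      conj ((𝓕 (TopologicalSpace.denseSeq N j : L2 d) : L2 d) η) *
        (𝓕 u : L2 (d + 1)) (joinEquiv d (η, ζ)) = 0 :=
    ae_all_iff.2 fun j => ae_integral_slice_eq_zero hu (TopologicalSpace.denseSeq N j).2
  filter_upwards [hall, ae_memLp_slice (𝓕 u : L2 (d + 1))] with ζ hζ hm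
  set W : L2 d := hm.toLp _ with hW
  have hWc : ∀ᵐ η : E d, W η = (𝓕 u : L2 (d + 1)) (joinEquiv d (η, ζ)) := hm.coeFn_toLp
  refine ⟨(𝓕⁻ W : L2 d), ae_eq_zero_of_inner_eq_zero hK fun g hg => ?_, ?_⟩
  · have hj (j : ℕ) : inner ℂ (TopologicalSpace.denseSeq N j : L2 d) (𝓕⁻ W : L2 d) = 0 := by
      rw [← Lp.inner_fourier_eq, FourierTransform.fourier_fourierInv_eq, inner_eq_integral,
        ← hζ j]
      refine integral_congr_ae ?_
      filter_upwards [hWc] with η hη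
      rw [hη]
    have hcl : IsClosed {g : N | inner ℂ (g : L2 d) (𝓕⁻ W : L2 d) = 0} :=
      isClosed_eq (by fun_prop) continuous_const
    exact (TopologicalSpace.denseRange_denseSeq N).induction_on
      (p := fun g : N => inner ℂ (g : L2 d) (𝓕⁻ W : L2 d) = 0) ⟨g, hg⟩ hcl hj
  · rw [FourierTransform.fourier_fourierInv_eq]
    exact hWc

/-- Almost every slice of the Fourier transform of a function in `H̃ˢ(ω × ℝ)` is the Fourier
transform of a function in `H̃ˢ(ω)`. -/
theorem ae_exists_slice_formDomain {d : ℕ} {s : ℝ} (hs : s ∈ Ioo (0 : ℝ) 1) {ω : Set (E d)}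
    (u : formDomain s (tube ω)) :
    ∀ᵐ ζ : ℝ, ∃ w : formDomain s ω,
      (∀ᵐ η : E d, (𝓕 (w : L2 d) : L2 d) η =
        (𝓕 (u : L2 (d + 1)) : L2 (d + 1)) (joinEquiv d (η, ζ))) ∧
      ∀ᵐ η : E d, symbMul hs ζ ω w η = symbMul hs 0 (tube ω) u (joinEquiv d (η, ζ)) := by
  have hu : ∀ᵐ p : E d × ℝ, p.1 ∉ closure ω → (u : L2 (d + 1)) (joinEquiv d p) = 0 := by
    filter_upwards [ae_joinEquiv u.2.2] with p hp hpω
    exact hp (fun h => hpω ((joinEquiv_mem_closure_tube p).1 h))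
  have hM : ∀ᵐ ζ : ℝ, ∀ᵐ η : E d, symbMul hs 0 (tube ω) u (joinEquiv d (η, ζ)) =
      (rootSymb s ζ η : ℂ) * (𝓕 (u : L2 (d + 1)) : L2 (d + 1)) (joinEquiv d (η, ζ)) := by
    have h := ae_joinEquiv (coeFn_symbMul hs 0 u)
    have h' := Measure.ae_ae_of_ae_prod
      ((Measure.measurePreserving_swap (μ := (volume : Measure ℝ))
        (ν := (volume : Measure (E d)))).quasiMeasurePreserving.ae h)
    filter_upwards [h'] with ζ hζ
    filter_upwards [hζ] with η hη
    have := rootSymb_joinEquiv s (η, ζ)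
    simp only [Prod.swap_prod_mk] at hη
    rw [hη, this]
  filter_upwards [ae_exists_slice isClosed_closure.measurableSet hu, hM,
    ae_memLp_slice (symbMul hs 0 (tube ω) u)] with ζ ⟨w, hw0, hw⟩ hζ hm
  have hw' : ∀ᵐ η : E d, symbMul hs 0 (tube ω) u (joinEquiv d (η, ζ)) =
      (rootSymb s ζ η : ℂ) * (𝓕 w : L2 d) η := by
    filter_upwards [hζ, hw] with η h1 h2
    rw [h1, h2]
  refine ⟨⟨w, (memHs_iff_rootSymb hs ζ).2 (hm.ae_eq hw'), hw0⟩, hw, ?_⟩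
  filter_upwards [coeFn_symbMul hs ζ (⟨w, (memHs_iff_rootSymb hs ζ).2 (hm.ae_eq hw'), hw0⟩ :
    formDomain s ω), hw'] with η h1 h2
  rw [h1, h2]

/-! ### Existence of ground states on a bounded cross-section -/

theorem memHs_toLp_schwartzMap {n : ℕ} {s : ℝ} (hs : s ∈ Ioo (0 : ℝ) 1)
    (G : SchwartzMap (E n) ℂ) : MemHs s (G.toLp 2 : L2 n) := by
  rw [memHs_iff, SchwartzMap.toLp_fourier_eq]
  have hg : Function.HasTemperateGrowth (fun η : E n => (1 + ‖η‖ ^ 2 : ℝ)) := by fun_prop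
  have hH := ((SchwartzMap.smulLeftCLM ℂ (fun η : E n => (1 + ‖η‖ ^ 2 : ℝ)) (𝓕 G)).memLp 2
    (μ := volume)).const_mul ((1 + Real.pi : ℝ) : ℂ)
  refine hH.of_le ((Complex.continuous_ofReal.comp
    (continuous_rootSymb hs.1 0)).aestronglyMeasurable.mul (Lp.aestronglyMeasurable _)) ?_
  filter_upwards [(𝓕 G).coeFn_toLp 2 volume] with η hη
  rw [hη, SchwartzMap.smulLeftCLM_apply_apply hg, norm_mul, norm_mul, norm_smul, ← mul_assoc,
    Complex.norm_real, Complex.norm_real, Real.norm_of_nonneg (rootSymb_nonneg _ _ _),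
    Real.norm_of_nonneg (by positivity), Real.norm_of_nonneg (by positivity)]
  gcongr
  rw [rootSymb_zero]
  have h1 : (2 * Real.pi * ‖η‖) ^ s ≤ 1 + 2 * Real.pi * ‖η‖ := by
    have h0 : 0 ≤ 2 * Real.pi * ‖η‖ := by positivity
    calc (2 * Real.pi * ‖η‖) ^ s ≤ (1 + 2 * Real.pi * ‖η‖) ^ s :=
          Real.rpow_le_rpow h0 (by linarith) hs.1.le
      _ ≤ (1 + 2 * Real.pi * ‖η‖) ^ (1 : ℝ) :=
          Real.rpow_le_rpow_of_exponent_le (by linarith) hs.2.le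
      _ = _ := Real.rpow_one _
  nlinarith [mul_nonneg Real.pi_pos.le (sq_nonneg (‖η‖ - 1)), sq_nonneg ‖η‖]

theorem norm_normalize_eq_one {n : ℕ} {s : ℝ} {Ω : Set (E n)} (u : formDomain s Ω)
    (hu : (u : L2 n) ≠ 0) : ‖((((‖(u : L2 n)‖⁻¹ : ℝ) : ℂ) • u : formDomain s Ω) : L2 n)‖ = 1 := by
  rw [Submodule.coe_smul, norm_smul, Complex.norm_real, norm_inv, norm_norm,
    inv_mul_cancel₀ (norm_ne_zero_iff.2 hu)]

theorem exists_formDomain_norm_eq_one {n : ℕ} {s : ℝ} (hs : s ∈ Ioo (0 : ℝ) 1) {Ω : Set (E n)}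
    (ho : IsOpen Ω) (hne : Ω.Nonempty) : ∃ u : formDomain s Ω, ‖(u : L2 n)‖ = 1 := by
  obtain ⟨c, hc⟩ := hne
  obtain ⟨r, hr, hball⟩ := Metric.isOpen_iff.1 ho c hc
  let b : ContDiffBump c := ⟨r / 2, r, by positivity, by linarith⟩
  have h1 : ContDiff ℝ (⊤ : ℕ∞) (fun x => (b x : ℂ)) := Complex.ofRealCLM.contDiff.comp b.contDiff
  have h2 : HasCompactSupport (fun x => (b x : ℂ)) :=
    b.hasCompactSupport.comp_left (g := fun r : ℝ => (r : ℂ)) Complex.ofReal_zero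
  set G := h2.toSchwartzMap h1
  have hG : ∀ x, G x = (b x : ℂ) := fun x => rfl
  set u : L2 n := G.toLp 2 with hu
  have hcoe : ∀ᵐ x, u x = (b x : ℂ) := G.coeFn_toLp 2 volume
  have hmem : u ∈ formDomain s Ω := by
    refine ⟨memHs_toLp_schwartzMap hs G, ?_⟩
    filter_upwards [hcoe] with x hx hxΩ
    have : x ∉ Function.support b := by
      rw [b.support_eq]
      exact fun h => hxΩ (subset_closure (hball h))
    rw [hx, Function.notMem_support.1 this, Complex.ofReal_zero]
  have hne : u ≠ 0 := by
    intro h0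
    rw [h0] at hcoe
    have h3 : ∀ᵐ x : E n, b x = 0 := by
      filter_upwards [hcoe, Lp.coeFn_zero ℂ 2 (volume : Measure (E n))] with x hx hx0
      rw [hx0, Pi.zero_apply] at hx
      exact_mod_cast hx.symm
    have h4 := b.continuous.ae_eq_iff_eq (μ := (volume : Measure (E n))) continuous_const |>.1 h3
    have h5 := congrFun h4 c
    rw [b.one_of_mem_closedBall (Metric.mem_closedBall_self (by positivity))] at h5
    norm_num at h5
  exact ⟨_, norm_normalize_eq_one ⟨u, hmem⟩ hne⟩

/-- For functions supported in a set `K` of finite measure, the value of the Fourier transform at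
`η` is a bounded linear functional, uniformly in `η`. -/
theorem exists_inner_eq_fourier {n : ℕ} {K : Set (E n)} (hK : MeasurableSet K)
    (hKf : volume K ≠ ⊤) : ∃ (φ : E n → L2 n) (C : ℝ), (∀ η, ‖φ η‖ ≤ C) ∧
      ∀ w : L2 n, (∀ᵐ x, x ∉ K → w x = 0) →
        ∀ᵐ η, (𝓕 w : L2 n) η = inner ℂ (φ η) w := by
  have hm (η : E n) : MemLp (K.indicator (fun x =>
      conj (Complex.exp (↑(-2 * Real.pi * inner ℝ x η) * Complex.I)))) 2 volume := by
    have h1 : MemLp (fun x : E n => conj (Complex.exp (↑(-2 * Real.pi * inner ℝ x η) * Complex.I)))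
        2 (volume.restrict K) := by
      have : IsFiniteMeasure (volume.restrict K) := ⟨by simpa using hKf.lt_top⟩
      refine MemLp.of_bound (Continuous.aestronglyMeasurable (by fun_prop)) 1
        (Eventually.of_forall fun x => ?_)
      rw [RCLike.norm_conj, Complex.norm_exp_ofReal_mul_I]
    exact (memLp_indicator_iff_restrict hK).2 h1
  have hae (η : E n) := (hm η).coeFn_toLp
  refine ⟨fun η => (hm η).toLp _, ‖indicatorConstLp 2 hK hKf (1 : ℂ)‖, fun η => ?_,
    fun w hw => ?_⟩
  · refine Lp.norm_le_norm_of_ae_le ?_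
    filter_upwards [hae η, indicatorConstLp_coeFn (p := 2) (hs := hK) (hμs := hKf) (c := (1 : ℂ))]
      with x h1 h2
    rw [h1, h2]
    by_cases hx : x ∈ K
    · simp only [hx, indicator_of_mem]
      rw [RCLike.norm_conj, Complex.norm_exp_ofReal_mul_I, norm_one]
    · simp [hx]
  · have hint : Integrable w volume := by
      have h1 : IntegrableOn w K := by
        have : IsFiniteMeasure (volume.restrict K) := ⟨by simpa using hKf.lt_top⟩
        exact ((Lp.memLp w).restrict K).integrable (by norm_num)
      refine ((integrable_indicator_iff hK).2 h1).congr ?_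
      filter_upwards [hw] with x hx
      by_cases hxK : x ∈ K
      · simp [hxK]
      · simp [hxK, hx hxK]
    filter_upwards [coeFn_fourier_ae_eq w hint] with η hη
    rw [hη, Real.fourier_eq', inner_eq_integral]
    refine integral_congr_ae ?_
    filter_upwards [hae η, hw] with x h1 h2
    rw [h1, smul_eq_mul]
    by_cases hxK : x ∈ K
    · simp [hxK]
    · simp [h2 hxK]

/-- Bounded sequences in `L₂` have weakly convergent subsequences. -/
theorem exists_weak_limit {n : ℕ} (w : ℕ → L2 n) {C : ℝ} (hw : ∀ k, ‖w k‖ ≤ C) :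
    ∃ (a : L2 n) (φ : ℕ → ℕ), StrictMono φ ∧
      ∀ g : L2 n, Tendsto (fun k => inner ℂ g (w (φ k))) atTop (𝓝 (inner ℂ g a)) := by
  have : Fact ((2 : ENNReal) ≠ ⊤) := ⟨by norm_num⟩
  have : SecondCountableTopology (L2 n) := Lp.SecondCountableTopology
  obtain ⟨a, -, φ, hφ, hlim⟩ := WeakDual.isSeqCompact_closedBall ℂ (L2 n) 0 C
    (x := fun k => StrongDual.toWeakDual (InnerProductSpace.toDual ℂ (L2 n) (w k)))
    (fun k => by
      rw [mem_preimage, mem_closedBall_zero_iff]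
      exact ((InnerProductSpace.toDual ℂ (L2 n)).norm_map (w k)).trans_le (hw k))
  refine ⟨(InnerProductSpace.toDual ℂ (L2 n)).symm (WeakDual.toStrongDual a), φ, hφ, fun g => ?_⟩
  have h1 := ((WeakDual.eval_continuous (𝕜 := ℂ) g).tendsto a).comp hlim
  have h2 := (Complex.continuous_conj.tendsto _).comp h1
  have h3 : conj (a g) = inner ℂ g
      ((InnerProductSpace.toDual ℂ (L2 n)).symm (WeakDual.toStrongDual a)) := by
    rw [← inner_conj_symm, InnerProductSpace.toDual_symm_apply]
    rfl
  rw [← h3]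
  refine h2.congr fun k => ?_
  have h4 : (StrongDual.toWeakDual (InnerProductSpace.toDual ℂ (L2 n) (w (φ k)))) g =
    inner ℂ (w (φ k)) g := rfl
  simp only [Function.comp_apply, h4, inner_conj_symm]

theorem rootSymb_sq_ge {s : ℝ} (hs : 0 < s) (t : ℝ) {n : ℕ} {R : ℝ} (hR : 0 ≤ R) {η : E n}
    (h : R ≤ ‖η‖) : (R ^ 2) ^ s ≤ rootSymb s t η ^ 2 := by
  rw [rootSymb_sq]
  refine Real.rpow_le_rpow (by positivity) ?_ hs.le
  have h1 : R ^ 2 ≤ ‖η‖ ^ 2 := by gcongr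
  have h2 : (1 : ℝ) ≤ (2 * Real.pi) ^ 2 := by nlinarith [Real.pi_gt_three]
  nlinarith [sq_nonneg t, sq_nonneg ‖η‖]

theorem norm_sq_symbMul {n : ℕ} {s : ℝ} (hs : s ∈ Ioo (0 : ℝ) 1) (t : ℝ) {Ω : Set (E n)}
    (u : formDomain s Ω) :
    Integrable (fun η => rootSymb s t η ^ 2 * ‖(𝓕 (u : L2 n) : L2 n) η‖ ^ 2) ∧
    ‖symbMul hs t Ω u‖ ^ 2 = ∫ η, rootSymb s t η ^ 2 * ‖(𝓕 (u : L2 n) : L2 n) η‖ ^ 2 := by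
  have h : ∀ᵐ η, ‖symbMul hs t Ω u η‖ ^ 2 =
      rootSymb s t η ^ 2 * ‖(𝓕 (u : L2 n) : L2 n) η‖ ^ 2 := by
    filter_upwards [coeFn_symbMul hs t u] with η hη
    rw [hη, norm_mul, mul_pow, Complex.norm_real, Real.norm_eq_abs, sq_abs]
  refine ⟨?_, by rw [norm_sq_eq_integral, integral_congr_ae h]⟩
  have hm := Lp.memLp (symbMul hs t Ω u)
  exact ((memLp_two_iff_integrable_sq_norm hm.1).1 hm).congr h

theorem integrable_norm_sq {n : ℕ} (u : L2 n) : Integrable (fun x => ‖u x‖ ^ 2) volume :=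
  (memLp_two_iff_integrable_sq_norm (Lp.memLp u).1).1 (Lp.memLp u)

theorem norm_sq_eq_integral_fourier {n : ℕ} (u : L2 n) :
    ‖u‖ ^ 2 = ∫ η, ‖(𝓕 u : L2 n) η‖ ^ 2 := by
  rw [← Lp.norm_fourier_eq u, norm_sq_eq_integral]

/-- A bound on the form controls the mass of the Fourier transform at high frequencies. -/
theorem norm_sq_le_setIntegral_add {n : ℕ} {s : ℝ} (hs : s ∈ Ioo (0 : ℝ) 1) (t : ℝ)
    {Ω : Set (E n)} (u : formDomain s Ω) {R : ℝ} (hR : 0 < R) :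
    ‖(u : L2 n)‖ ^ 2 ≤ (∫ η in Metric.ball 0 R, ‖(𝓕 (u : L2 n) : L2 n) η‖ ^ 2) +
      ((R ^ 2) ^ s)⁻¹ * ‖symbMul hs t Ω u‖ ^ 2 := by
  obtain ⟨hi, he⟩ := norm_sq_symbMul hs t u
  have hi0 := integrable_norm_sq (𝓕 (u : L2 n) : L2 n)
  rw [norm_sq_eq_integral_fourier, he, ← integral_const_mul,
    ← integral_indicator Metric.isOpen_ball.measurableSet,
    ← integral_add (hi0.indicator Metric.isOpen_ball.measurableSet) (hi.const_mul _)]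
  refine integral_mono hi0 ((hi0.indicator Metric.isOpen_ball.measurableSet).add
    (hi.const_mul _)) fun η => ?_
  have hL : 0 < (R ^ 2) ^ s := by positivity
  by_cases hη : η ∈ Metric.ball (0 : E n) R
  · simp only [hη, indicator_of_mem]
    exact le_add_of_nonneg_right (by positivity)
  · have h1 : R ≤ ‖η‖ := by simpa using hη
    have h2 := rootSymb_sq_ge hs.1 t hR.le h1
    simp only [hη, not_false_eq_true, indicator_of_notMem, zero_add, ← mul_assoc]
    refine le_mul_of_one_le_left (by positivity) ?_
    rwa [inv_mul_eq_div, one_le_div hL]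

/-- The infimum of the fibre form at frequency `t` over the elements of `H̃ˢ(Ω)` of `L₂` norm `1`.
There are such elements if `Ω` is open and nonempty; otherwise the value may be the junk value
`0`. -/
def groundEnergy {n : ℕ} {s : ℝ} (hs : s ∈ Ioo (0 : ℝ) 1) (t : ℝ) (Ω : Set (E n)) : ℝ :=
  sInf ((fun u : formDomain s Ω => ‖symbMul hs t Ω u‖ ^ 2) '' {u | ‖(u : L2 n)‖ = 1})

theorem bddBelow_symbMul {n : ℕ} {s : ℝ} (hs : s ∈ Ioo (0 : ℝ) 1) (t : ℝ) (Ω : Set (E n)) :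
    BddBelow ((fun u : formDomain s Ω => ‖symbMul hs t Ω u‖ ^ 2) '' {u | ‖(u : L2 n)‖ = 1}) :=
  ⟨0, by rintro _ ⟨u, -, rfl⟩; positivity⟩

theorem groundEnergy_nonneg {n : ℕ} {s : ℝ} (hs : s ∈ Ioo (0 : ℝ) 1) (t : ℝ) (Ω : Set (E n)) :
    0 ≤ groundEnergy hs t Ω :=
  Real.sInf_nonneg (by rintro _ ⟨u, -, rfl⟩; positivity)

theorem groundEnergy_mul_le {n : ℕ} {s : ℝ} (hs : s ∈ Ioo (0 : ℝ) 1) (t : ℝ) {Ω : Set (E n)}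
    (u : formDomain s Ω) : groundEnergy hs t Ω * ‖(u : L2 n)‖ ^ 2 ≤ ‖symbMul hs t Ω u‖ ^ 2 := by
  by_cases hu : (u : L2 n) = 0
  · rw [hu, norm_zero]; simp
  have hpos : 0 < ‖(u : L2 n)‖ := norm_pos_iff.2 hu
  have h := csInf_le (bddBelow_symbMul hs t Ω) ⟨_, norm_normalize_eq_one u hu, rfl⟩
  simp only [map_smul, norm_smul, Complex.norm_real, norm_inv, norm_norm, mul_pow, inv_pow] at h
  rwa [inv_mul_eq_div, le_div_iff₀ (by positivity)] at h

/-- The infimum is attained. A minimizing sequence has a weak limit; for functions supported in a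
bounded set weak convergence gives pointwise convergence of the Fourier transforms. The form is
lower semicontinuous by Fatou's lemma, and no mass is lost, since on a ball of frequencies
dominated convergence applies while the form controls the complement. -/
theorem exists_groundState {n : ℕ} {s : ℝ} (hs : s ∈ Ioo (0 : ℝ) 1) (t : ℝ) {Ω : Set (E n)}
    (ho : IsOpen Ω) (hne : Ω.Nonempty) (hb : Bornology.IsBounded Ω) :
    ∃ u : formDomain s Ω, ‖(u : L2 n)‖ = 1 ∧
      ‖symbMul hs t Ω u‖ ^ 2 = groundEnergy hs t Ω := by
  set m := groundEnergy hs t Ω with hm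
  have hK : MeasurableSet (closure Ω) := isClosed_closure.measurableSet
  have hKf : volume (closure Ω) ≠ ⊤ := hb.closure.measure_lt_top.ne
  obtain ⟨φ, C, hC, hφ⟩ := exists_inner_eq_fourier hK hKf
  obtain ⟨u0, hu0⟩ := exists_formDomain_norm_eq_one hs ho hne
  obtain ⟨y, -, hy, hyS⟩ := exists_seq_tendsto_sInf (α := ℝ)
    ⟨_, mem_image_of_mem (fun u : formDomain s Ω => ‖symbMul hs t Ω u‖ ^ 2)
      (show u0 ∈ {u : formDomain s Ω | ‖(u : L2 n)‖ = 1} from hu0)⟩ (bddBelow_symbMul hs t Ω)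
  choose w' hw1' hwy' using hyS
  obtain ⟨a, κ, hκ, hweak⟩ := exists_weak_limit (fun k => (w' k : L2 n)) (C := 1)
    fun k => (hw1' k).le
  set w : ℕ → formDomain s Ω := fun k => w' (κ k) with hw
  have hw1 (k : ℕ) : ‖(w k : L2 n)‖ = 1 := hw1' (κ k)
  have hwm : Tendsto (fun k => ‖symbMul hs t Ω (w k)‖ ^ 2) atTop (𝓝 m) :=
    (hy.comp hκ.tendsto_atTop).congr fun k => (hwy' (κ k)).symm
  have ha0 : ∀ᵐ x, x ∉ closure Ω → a x = 0 := by
    refine ae_eq_zero_of_inner_eq_zero hK fun g hg => ?_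
    refine tendsto_nhds_unique (hweak g) (tendsto_const_nhds.congr fun k => ?_)
    rw [inner_eq_integral, integral_eq_zero_of_ae]
    filter_upwards [hg, (w k).2.2] with x h1 h2
    by_cases hx : x ∈ closure Ω
    · simp [h1 hx]
    · have := h2 hx
      simp only [hw] at this
      simp [this]
  have hpt : ∀ᵐ η, Tendsto (fun k => (𝓕 (w k : L2 n) : L2 n) η) atTop (𝓝 ((𝓕 a : L2 n) η)) := by
    filter_upwards [hφ a ha0, ae_all_iff.2 fun k => hφ (w k) (w k).2.2] with η h1 h2
    rw [h1]
    exact (hweak (φ η)).congr fun k => (h2 k).symm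
  have hbd : ∀ k, ∀ᵐ η, ‖(𝓕 (w k : L2 n) : L2 n) η‖ ^ 2 ≤ C ^ 2 := by
    intro k
    filter_upwards [hφ (w k) (w k).2.2] with η h
    rw [h]
    gcongr
    refine (norm_inner_le_norm _ _).trans ?_
    rw [hw1 k, mul_one]
    exact hC η
  -- lower semicontinuity of the form
  have hfatou : eLpNorm (fun η => (rootSymb s t η : ℂ) * (𝓕 a : L2 n) η) 2 volume ≤
      ENNReal.ofReal (√m) := by
    have hmeas (v : L2 n) : AEStronglyMeasurable
        (fun η => (rootSymb s t η : ℂ) * (𝓕 v : L2 n) η) volume :=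
      (Complex.continuous_ofReal.comp (continuous_rootSymb hs.1 t)).aestronglyMeasurable.mul
        (Lp.aestronglyMeasurable _)
    refine (Lp.eLpNorm_lim_le_liminf_eLpNorm (fun k => hmeas (w k)) _ ?_).trans ?_
    · filter_upwards [hpt] with η hη
      exact hη.const_mul _
    · have h1 : Tendsto (fun k => eLpNorm (fun η => (rootSymb s t η : ℂ) *
          (𝓕 (w k : L2 n) : L2 n) η) 2 volume) atTop (𝓝 (ENNReal.ofReal (√m))) := by
        refine (ENNReal.tendsto_ofReal ((Real.continuous_sqrt.tendsto m).comp hwm)).congr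
          fun k => ?_
        rw [Function.comp_apply, Real.sqrt_sq (norm_nonneg _), Lp.norm_def,
          ENNReal.ofReal_toReal (Lp.eLpNorm_ne_top _)]
        exact eLpNorm_congr_ae (coeFn_symbMul hs t (w k))
      exact h1.liminf_eq.le
  have hmemLp : MemLp (fun η => (rootSymb s t η : ℂ) * (𝓕 a : L2 n) η) 2 volume :=
    ⟨(Complex.continuous_ofReal.comp (continuous_rootSymb hs.1 t)).aestronglyMeasurable.mul
        (Lp.aestronglyMeasurable _), hfatou.trans_lt ENNReal.ofReal_lt_top⟩
  let v : formDomain s Ω := ⟨a, (memHs_iff_rootSymb hs t).2 hmemLp, ha0⟩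
  have hvm : ‖symbMul hs t Ω v‖ ^ 2 ≤ m := by
    have h1 : ‖symbMul hs t Ω v‖ ≤ √m := by
      rw [Lp.norm_def, eLpNorm_congr_ae (coeFn_symbMul hs t v)]
      exact ENNReal.toReal_le_of_le_ofReal (Real.sqrt_nonneg _) hfatou
    calc _ ≤ √m ^ 2 := by gcongr
      _ = m := Real.sq_sqrt (groundEnergy_nonneg hs t Ω)
  -- as the frequency cutoff `R` tends to infinity, the bound on the mass outside it tends to `0`
  have hmass : 1 ≤ ‖(v : L2 n)‖ ^ 2 := by
    have hR (R : ℝ) (hR : 0 < R) : 1 ≤ ‖(v : L2 n)‖ ^ 2 + ((R ^ 2) ^ s)⁻¹ * m := by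
      have h1 : Tendsto (fun k => ∫ η in Metric.ball 0 R, ‖(𝓕 (w k : L2 n) : L2 n) η‖ ^ 2) atTop
          (𝓝 (∫ η in Metric.ball 0 R, ‖(𝓕 a : L2 n) η‖ ^ 2)) := by
        refine tendsto_integral_of_dominated_convergence (fun _ => C ^ 2) (fun k => ?_) ?_
          (fun k => ?_) ?_
        · exact ((Lp.aestronglyMeasurable _).norm.pow 2).restrict
        · exact integrableOn_const Metric.isBounded_ball.measure_lt_top.ne
        · filter_upwards [ae_restrict_of_ae (hbd k)] with η hη
          rwa [Real.norm_of_nonneg (by positivity)]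
        · filter_upwards [ae_restrict_of_ae hpt] with η hη
          exact (hη.norm.pow 2)
      have h2 := h1.add (hwm.const_mul ((R ^ 2) ^ s)⁻¹)
      have h3 := ge_of_tendsto' h2 (b := 1) fun k => by
        have := norm_sq_le_setIntegral_add hs t (w k) hR
        rwa [hw1 k, one_pow] at this
      refine h3.trans ?_
      gcongr
      rw [norm_sq_eq_integral_fourier]
      exact setIntegral_le_integral (integrable_norm_sq _)
        (Eventually.of_forall fun η => by positivity)
    have h4 : Tendsto (fun R : ℝ => ‖(v : L2 n)‖ ^ 2 + ((R ^ 2) ^ s)⁻¹ * m) atTop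
        (𝓝 (‖(v : L2 n)‖ ^ 2 + 0 * m)) :=
      (((tendsto_rpow_atTop hs.1).comp (tendsto_pow_atTop two_ne_zero)).inv_tendsto_atTop.mul_const
        m).const_add _
    rw [zero_mul, add_zero] at h4
    exact ge_of_tendsto h4 (eventually_gt_atTop 0 |>.mono hR)
  have hv0 : (v : L2 n) ≠ 0 := by
    intro h0
    rw [h0, norm_zero] at hmass
    norm_num at hmass
  have h1 := norm_normalize_eq_one v hv0
  refine ⟨_, h1, le_antisymm ?_ ?_⟩
  · simp only [map_smul, norm_smul, Complex.norm_real, norm_inv, norm_norm, mul_pow, inv_pow]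
    rw [inv_mul_eq_div]
    exact (div_le_self (by positivity) hmass).trans hvm
  · have h2 := groundEnergy_mul_le hs t (((‖(v : L2 n)‖⁻¹ : ℝ) : ℂ) • v)
    rwa [h1, one_pow, mul_one] at h2

/-- The Euler-Lagrange equation of a ground state. -/
theorem inner_symbMul_groundState {n : ℕ} {s : ℝ} (hs : s ∈ Ioo (0 : ℝ) 1) (t : ℝ) {Ω : Set (E n)}
    {u : formDomain s Ω} (hu : ‖(u : L2 n)‖ = 1)
    (hmin : ‖symbMul hs t Ω u‖ ^ 2 = groundEnergy hs t Ω) (v : formDomain s Ω) :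
    inner ℂ (symbMul hs t Ω v) (symbMul hs t Ω u) =
      (groundEnergy hs t Ω : ℂ) * inner ℂ (v : L2 n) (u : L2 n) := by
  set m := groundEnergy hs t Ω
  set M := symbMul hs t Ω
  set β : ℂ := inner ℂ (M v) (M u) - (m : ℂ) * inner ℂ (v : L2 n) (u : L2 n) with hβ
  set q : ℝ := ‖M v‖ ^ 2 - m * ‖(v : L2 n)‖ ^ 2 with hq
  have hq0 : 0 ≤ q := sub_nonneg.2 (groundEnergy_mul_le hs t v)
  -- nonnegativity of the shifted form at `u - ε β v`
  have key (ε : ℝ) : 0 ≤ -2 * ε * ‖β‖ ^ 2 + ε ^ 2 * ‖β‖ ^ 2 * q := by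
    have h := groundEnergy_mul_le hs t (u + (-(ε * β : ℂ)) • v)
    rw [map_add, map_smul, Submodule.coe_add, Submodule.coe_smul, @norm_add_sq ℂ, @norm_add_sq ℂ,
      inner_smul_right, inner_smul_right, norm_smul, norm_smul, hu] at h
    have hre : RCLike.re (-(ε * β : ℂ) * inner ℂ (M u) (M v)) -
        m * RCLike.re (-(ε * β : ℂ) * inner ℂ (u : L2 n) (v : L2 n)) = -ε * ‖β‖ ^ 2 := by
      have h1 : conj β = inner ℂ (M u) (M v) - (m : ℂ) * inner ℂ (u : L2 n) (v : L2 n) := by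
        rw [hβ, map_sub, map_mul, inner_conj_symm, inner_conj_symm, Complex.conj_ofReal]
      have h2 : ((-ε * ‖β‖ ^ 2 : ℝ) : ℂ) = -(ε * β : ℂ) * conj β := by
        rw [show -(ε * β : ℂ) * conj β = -(ε * (β * conj β)) by ring, Complex.mul_conj,
          Complex.normSq_eq_norm_sq]
        push_cast; ring
      have h3 := congrArg Complex.re h2
      rw [h1, Complex.ofReal_re] at h3
      rw [h3]
      have h4 : ∀ z x y : ℂ, (z * (x - (m : ℂ) * y)).re = (z * x).re - m * (z * y).re := by
        intro z x y
        rw [mul_sub, Complex.sub_re, mul_left_comm, Complex.re_ofReal_mul]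
      rw [h4]
      rfl
    have hn : ‖(-(ε * β : ℂ))‖ ^ 2 = ε ^ 2 * ‖β‖ ^ 2 := by
      rw [norm_neg, norm_mul, mul_pow, Complex.norm_real, Real.norm_eq_abs, sq_abs]
    rw [mul_pow, mul_pow, hn, hmin] at h
    rw [hq]
    nlinarith
  have hβ0 : ‖β‖ ^ 2 = 0 := by
    have h1 := key (1 / (q + 1))
    have h2 : -2 * (1 / (q + 1)) * ‖β‖ ^ 2 + (1 / (q + 1)) ^ 2 * ‖β‖ ^ 2 * q =
        -(‖β‖ ^ 2 * ((q + 2) / (q + 1) ^ 2)) := by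
      field_simp; ring
    rw [h2] at h1
    have h3 : 0 < (q + 2) / (q + 1) ^ 2 := by positivity
    nlinarith [sq_nonneg ‖β‖]
  exact sub_eq_zero.1 (norm_eq_zero.1 (pow_eq_zero_iff two_ne_zero |>.1 hβ0))

theorem abs_groundEnergy_sub_le {n : ℕ} {s : ℝ} (hs : s ∈ Ioo (0 : ℝ) 1) {Ω : Set (E n)}
    (ho : IsOpen Ω) (hne : Ω.Nonempty) (hb : Bornology.IsBounded Ω) (t t' : ℝ) :
    |groundEnergy hs t Ω - groundEnergy hs t' Ω| ≤ ((2 * Real.pi) ^ 2 * |t ^ 2 - t' ^ 2|) ^ s := by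
  have key (t t' : ℝ) : groundEnergy hs t Ω - groundEnergy hs t' Ω ≤
      ((2 * Real.pi) ^ 2 * |t ^ 2 - t' ^ 2|) ^ s := by
    obtain ⟨u, hu, hmin⟩ := exists_groundState hs t' ho hne hb
    have h1 := groundEnergy_mul_le hs t u
    rw [hu, one_pow, mul_one] at h1
    obtain ⟨hi, he⟩ := norm_sq_symbMul hs t u
    obtain ⟨hi', he'⟩ := norm_sq_symbMul hs t' u
    have hi0 := integrable_norm_sq (𝓕 (u : L2 n) : L2 n)
    have h2 : ‖symbMul hs t Ω u‖ ^ 2 ≤ ‖symbMul hs t' Ω u‖ ^ 2 +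
        ((2 * Real.pi) ^ 2 * |t ^ 2 - t' ^ 2|) ^ s * ‖(u : L2 n)‖ ^ 2 := by
      rw [he, he', norm_sq_eq_integral_fourier, ← integral_const_mul,
        ← integral_add hi' (hi0.const_mul _)]
      refine integral_mono hi (hi'.add (hi0.const_mul _)) fun η => ?_
      simp only [← add_mul]
      gcongr
      linarith [le_of_abs_le (abs_rootSymb_sq_sub_le hs t t' η)]
    rw [hu, one_pow, mul_one, hmin] at h2
    linarith
  refine abs_le.2 ⟨?_, key t t'⟩
  have := key t' t
  rw [abs_sub_comm] at this
  linarith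

theorem continuous_groundEnergy {n : ℕ} {s : ℝ} (hs : s ∈ Ioo (0 : ℝ) 1) {Ω : Set (E n)}
    (ho : IsOpen Ω) (hne : Ω.Nonempty) (hb : Bornology.IsBounded Ω) :
    Continuous fun t => groundEnergy hs t Ω := by
  refine continuous_iff_continuousAt.2 fun t => tendsto_iff_dist_tendsto_zero.2 ?_
  refine squeeze_zero (fun _ => dist_nonneg)
    (fun t' => abs_groundEnergy_sub_le hs ho hne hb t' t) ?_
  have hc : Continuous fun t' : ℝ => ((2 * Real.pi) ^ 2 * |t' ^ 2 - t ^ 2|) ^ s :=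
    Continuous.rpow_const (by fun_prop) fun _ => Or.inr hs.1.le
  have := hc.tendsto t
  simpa [Real.zero_rpow hs.1.ne'] using this

theorem rpow_le_groundEnergy {n : ℕ} {s : ℝ} (hs : s ∈ Ioo (0 : ℝ) 1) {Ω : Set (E n)}
    (ho : IsOpen Ω) (hne : Ω.Nonempty) (hb : Bornology.IsBounded Ω) (t : ℝ) :
    (t ^ 2) ^ s ≤ groundEnergy hs t Ω := by
  obtain ⟨u, hu, hmin⟩ := exists_groundState hs t ho hne hb
  obtain ⟨hi, he⟩ := norm_sq_symbMul hs t u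
  have hi0 := integrable_norm_sq (𝓕 (u : L2 n) : L2 n)
  rw [← hmin, he, ← mul_one ((t ^ 2) ^ s), ← one_pow 2, ← hu, norm_sq_eq_integral_fourier,
    ← integral_const_mul]
  refine integral_mono (hi0.const_mul _) hi fun η => ?_
  simp only [rootSymb_sq]
  have h2 : (1 : ℝ) ≤ (2 * Real.pi) ^ 2 := by nlinarith [Real.pi_gt_three]
  have h3 : t ^ 2 ≤ (2 * Real.pi) ^ 2 * (‖η‖ ^ 2 + t ^ 2) := by
    nlinarith [sq_nonneg t, sq_nonneg ‖η‖]
  have := hs.1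
  gcongr

/-- By the intermediate value theorem the ground energies fill the half-line from the one at
frequency `0`. -/
theorem exists_groundEnergy_eq {n : ℕ} {s : ℝ} (hs : s ∈ Ioo (0 : ℝ) 1) {Ω : Set (E n)}
    (ho : IsOpen Ω) (hne : Ω.Nonempty) (hb : Bornology.IsBounded Ω) {r : ℝ}
    (hr : groundEnergy hs 0 Ω ≤ r) : ∃ t, groundEnergy hs t Ω = r := by
  have h1 : Tendsto (fun t : ℝ => groundEnergy hs t Ω) atTop atTop :=
    tendsto_atTop_mono (rpow_le_groundEnergy hs ho hne hb)
      ((tendsto_rpow_atTop hs.1).comp (tendsto_pow_atTop two_ne_zero))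
  obtain ⟨T, hT, hT0⟩ := ((h1.eventually_ge_atTop r).and (eventually_ge_atTop 0)).exists
  obtain ⟨t, -, ht⟩ := intermediate_value_Icc hT0
    (continuous_groundEnergy hs ho hne hb).continuousOn ⟨hr, hT⟩
  exact ⟨t, ht⟩

/-! ### The resolvent -/

section Resolvent

variable {H : Type*} [NormedAddCommGroup H] [InnerProductSpace ℂ H]

/-- If `R₀ = (A + 1)⁻¹`, expressed through the graph of `A`, then `z` is a regular value of `A` as
soon as `1 - (z + 1) R₀` is invertible: the resolvent is `R₀ (1 - (z + 1) R₀)⁻¹`. -/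
theorem isRegularValue_of_isUnit {A : H →ₗ.[ℂ] H} {R₀ : H →L[ℂ] H}
    (hA : ∀ p : H × H, p ∈ A.graph ↔ p.1 = R₀ (p.1 + p.2)) {z : ℂ}
    (hz : IsUnit (1 - (z + 1) • R₀)) : IsRegularValue A z := by
  obtain ⟨U, hU⟩ := hz
  have h1 (f : H) : (↑U⁻¹ : H →L[ℂ] H) f - (z + 1) • R₀ ((↑U⁻¹ : H →L[ℂ] H) f) = f := by
    have := congrArg (fun T : H →L[ℂ] H => T f) U.mul_inv
    rw [hU] at this
    simpa using this
  have h2 (u : H) : (↑U⁻¹ : H →L[ℂ] H) (u - (z + 1) • R₀ u) = u := by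
    have := congrArg (fun T : H →L[ℂ] H => T u) U.inv_mul
    rw [hU] at this
    simpa using this
  have hcomm (g : H) : R₀ ((↑U⁻¹ : H →L[ℂ] H) g) = (↑U⁻¹ : H →L[ℂ] H) (R₀ g) := by
    rw [← h2 (R₀ ((↑U⁻¹ : H →L[ℂ] H) g)), ← map_smul, ← map_sub, h1]
  refine ⟨R₀ * ↑U⁻¹, fun f => ?_, fun u => ?_⟩
  · set g := (↑U⁻¹ : H →L[ℂ] H) f with hg
    have hmem : ((R₀ g, f + z • R₀ g) : H × H) ∈ A.graph := by
      rw [hA]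
      have e : R₀ g + (f + z • R₀ g) = g := by
        have h3 : g - (z + 1) • R₀ g = f := h1 f
        have h4 (a b c : H) (h : a - (z + 1) • b = c) : b + (c + z • b) = a := by
          rw [← h]; module
        exact h4 _ _ _ h3
      exact congrArg R₀ e.symm
    obtain ⟨y, hy1, hy2⟩ := (LinearPMap.mem_graph_iff A).1 hmem
    simp only at hy1 hy2
    have hdom : R₀ g ∈ A.domain := hy1 ▸ y.2
    refine ⟨hdom, ?_⟩
    have hy : (⟨R₀ g, hdom⟩ : A.domain) = y := Subtype.ext hy1.symm
    change A ⟨R₀ g, hdom⟩ - z • R₀ g = f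
    rw [hy, hy2, add_sub_cancel_right]
  · have hmem := (hA _).1 (A.mem_graph u)
    simp only at hmem
    change R₀ ((↑U⁻¹ : H →L[ℂ] H) (A u - z • (u : H))) = u
    rw [hcomm]
    conv_rhs => rw [← h2 (u : H)]
    congr 1
    have : A u - z • (u : H) = ((u : H) + A u) - (z + 1) • (u : H) := by module
    rw [this, map_sub, ← hmem, map_smul]

/-- The spectrum of a positive operator `R₀` lies in `[0, ‖R₀‖]`, so `1 - c R₀` can fail to be
invertible only for real `c ≥ ‖R₀‖⁻¹`. -/
theorem isUnit_one_sub_smul [CompleteSpace H] {R₀ : H →L[ℂ] H} (hpos : R₀.IsPositive) {m : ℝ}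
    (hm : 0 < m) (hnorm : ‖R₀‖ ≤ m⁻¹) {c : ℂ} (hc : ∀ r : ℝ, m ≤ r → c ≠ r) :
    IsUnit (1 - c • R₀) := by
  by_cases hc0 : c = 0
  · simp [hc0]
  have hns : c⁻¹ ∉ spectrum ℂ R₀ := by
    intro hmem
    have hre := hpos.isSelfAdjoint.mem_spectrum_eq_re hmem
    have hmem' : (c⁻¹).re ∈ spectrum ℝ R₀ := by
      rw [hre] at hmem
      exact (spectrum.algebraMap_mem_iff ℂ).1 hmem
    have h0 : 0 ≤ (c⁻¹).re :=
      spectrum_nonneg_of_nonneg ((ContinuousLinearMap.nonneg_iff_isPositive R₀).2 hpos) hmem'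
    have h1 : ‖c⁻¹‖ ≤ m⁻¹ := by
      refine (spectrum.norm_le_norm_mul_of_mem hmem).trans ?_
      calc ‖R₀‖ * ‖(1 : H →L[ℂ] H)‖ ≤ ‖R₀‖ * 1 := by
            gcongr
            exact ContinuousLinearMap.norm_id_le
        _ ≤ m⁻¹ := by rwa [mul_one]
    have h2 : (c⁻¹).re ≤ m⁻¹ := (Complex.re_le_norm _).trans h1
    have hpos' : 0 < (c⁻¹).re := lt_of_le_of_ne h0 fun h => by
      rw [← h, Complex.ofReal_zero, inv_eq_zero] at hre
      exact hc0 hre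
    refine hc ((c⁻¹).re)⁻¹ ((le_inv_comm₀ hpos' hm).1 h2) ?_
    rw [Complex.ofReal_inv, ← hre, inv_inv]
  have hu := spectrum.notMem_iff.1 hns
  have h3 : (1 : H →L[ℂ] H) - c • R₀ = (Units.mk0 c hc0) • (algebraMap ℂ (H →L[ℂ] H) c⁻¹ - R₀) := by
    rw [Units.smul_mk0, smul_sub, Algebra.algebraMap_eq_smul_one, smul_smul, mul_inv_cancel₀ hc0,
      one_smul]
  rw [h3]
  exact hu.smul _

theorem essSpectrum_subset_opSpectrum (A : H →ₗ.[ℂ] H) : essSpectrum A ⊆ opSpectrum A := by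
  rintro z ⟨u, hu, hlim⟩ ⟨R, -, hR⟩
  have h1 (k : ℕ) : 1 ≤ ‖R‖ * ‖A (u k) - z • (u k : H)‖ := by
    have h0 : ‖(u k : H)‖ = 1 := hu.1 k
    rw [← h0]
    conv_lhs => rw [← hR (u k)]
    exact R.le_opNorm _
  have h2 := ge_of_tendsto' (hlim.const_mul ‖R‖) h1
  rw [mul_zero] at h2
  exact absurd h2 (by norm_num)

end Resolvent

/-- The form domain with the form norm, realized as the graph of `symbMul` in `L₂ × L₂`. -/
def formGraph {n : ℕ} {s : ℝ} (hs : s ∈ Ioo (0 : ℝ) 1) (Ω : Set (E n)) :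
    Submodule ℂ (WithLp 2 (L2 n × L2 n)) :=
  ((WithLp.linearEquiv 2 ℂ (L2 n × L2 n)).symm.toLinearMap ∘ₗ
    (formDomain s Ω).subtype.prod (symbMul hs 0 Ω)).range

theorem mem_formGraph {n : ℕ} {s : ℝ} (hs : s ∈ Ioo (0 : ℝ) 1) {Ω : Set (E n)}
    {x : WithLp 2 (L2 n × L2 n)} : x ∈ formGraph hs Ω ↔
      ∃ u : formDomain s Ω, (u : L2 n) = x.fst ∧ symbMul hs 0 Ω u = x.snd := by
  constructor
  · rintro ⟨u, rfl⟩
    exact ⟨u, rfl, rfl⟩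
  · rintro ⟨u, h1, h2⟩
    refine ⟨u, ?_⟩
    apply WithLp.ofLp_injective
    exact Prod.ext h1 h2

/-- The form is closed: limits in the form norm can be identified almost everywhere along a
subsequence. -/
theorem isClosed_formGraph {n : ℕ} {s : ℝ} (hs : s ∈ Ioo (0 : ℝ) 1) (Ω : Set (E n)) :
    IsClosed (formGraph hs Ω : Set (WithLp 2 (L2 n × L2 n))) := by
  refine IsSeqClosed.isClosed fun x a hx hlim => ?_
  choose u hu1 hu2 using fun k => (mem_formGraph hs).1 (hx k)
  have h1 : Tendsto (fun k => (u k : L2 n)) atTop (𝓝 a.fst) := by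
    simp only [hu1]
    exact ((WithLp.fstL 2 ℂ (L2 n) (L2 n)).continuous.tendsto a).comp hlim
  have h2 : Tendsto (fun k => symbMul hs 0 Ω (u k)) atTop (𝓝 a.snd) := by
    simp only [hu2]
    exact ((WithLp.sndL 2 ℂ (L2 n) (L2 n)).continuous.tendsto a).comp hlim
  have h3 : Tendsto (fun k => (𝓕 (u k : L2 n) : L2 n)) atTop (𝓝 (𝓕 a.fst : L2 n)) :=
    ((Lp.fourierTransformₗᵢ (E n) ℂ).continuous.tendsto _).comp h1
  obtain ⟨κ, hκ, h3'⟩ := (tendstoInMeasure_of_tendsto_Lp h3).exists_seq_tendsto_ae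
  obtain ⟨ν, hν, h2'⟩ := (tendstoInMeasure_of_tendsto_Lp
    (h2.comp hκ.tendsto_atTop)).exists_seq_tendsto_ae
  have hae : ∀ᵐ η, a.snd η = (rootSymb s 0 η : ℂ) * (𝓕 a.fst : L2 n) η := by
    filter_upwards [h3', h2', ae_all_iff.2 fun k => coeFn_symbMul hs 0 (u k)] with η h4 h5 h6
    refine tendsto_nhds_unique h5 ?_
    refine ((h4.comp hν.tendsto_atTop).const_mul (rootSymb s 0 η : ℂ)).congr fun k => ?_
    exact (h6 _).symm
  have ha0 : ∀ᵐ x, x ∉ closure Ω → a.fst x = 0 := by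
    refine ae_eq_zero_of_inner_eq_zero isClosed_closure.measurableSet fun g hg => ?_
    have h4 : Tendsto (fun k => inner ℂ g (u k : L2 n)) atTop (𝓝 (inner ℂ g a.fst)) :=
      tendsto_const_nhds.inner h1
    refine tendsto_nhds_unique h4 (tendsto_const_nhds.congr fun k => ?_)
    rw [inner_eq_integral, integral_eq_zero_of_ae]
    filter_upwards [hg, (u k).2.2] with x h1 h2
    by_cases hx : x ∈ closure Ω
    · simp [h1 hx]
    · simp [h2 hx]
  have hmem : a.fst ∈ formDomain s Ω := ⟨memHs_iff.2 ((Lp.memLp a.snd).ae_eq hae), ha0⟩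
  refine (mem_formGraph hs).2 ⟨⟨a.fst, hmem⟩, rfl, Lp.ext ?_⟩
  filter_upwards [coeFn_symbMul hs 0 ⟨a.fst, hmem⟩, hae] with η h4 h5
  rw [h4, h5]

instance completeSpace_formGraph {n : ℕ} {s : ℝ} (hs : s ∈ Ioo (0 : ℝ) 1) (Ω : Set (E n)) :
    CompleteSpace (formGraph hs Ω) :=
  (isClosed_formGraph hs Ω).completeSpace_coe

/-- The embedding of the form domain, with the form norm, into the underlying Hilbert space. -/
def formEmbedding {n : ℕ} {s : ℝ} (hs : s ∈ Ioo (0 : ℝ) 1) (Ω : Set (E n)) :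
    formGraph hs Ω →L[ℂ] formHilbert s Ω :=
  ((WithLp.fstL 2 ℂ (L2 n) (L2 n)).comp (formGraph hs Ω).subtypeL).codRestrict _ fun x => by
    obtain ⟨u, hu, -⟩ := (mem_formGraph hs).1 x.2
    refine (formDomain s Ω).le_topologicalClosure ?_
    change (x : WithLp 2 (L2 n × L2 n)).fst ∈ _
    rw [← hu]
    exact u.2

theorem coe_formEmbedding {n : ℕ} {s : ℝ} (hs : s ∈ Ioo (0 : ℝ) 1) {Ω : Set (E n)}
    (x : formGraph hs Ω) :
    (formEmbedding hs Ω x : L2 n) = (x : WithLp 2 (L2 n × L2 n)).fst := rfl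

/-- With `J` the embedding of the form domain, `J J*` is the inverse of `A + 1`: the equation
`k = J* f` is the weak form of `(A + 1) k = f`. -/
theorem mem_opGraph_iff {n : ℕ} {s : ℝ} (hs : s ∈ Ioo (0 : ℝ) 1) {Ω : Set (E n)}
    (p : formHilbert s Ω × formHilbert s Ω) :
    p ∈ opGraph s Ω ↔ p.1 = (formEmbedding hs Ω ∘L
      ContinuousLinearMap.adjoint (formEmbedding hs Ω)) (p.1 + p.2) := by
  rw [ContinuousLinearMap.comp_apply]
  constructor
  · rintro ⟨hdom, hp⟩
    let k : formGraph hs Ω := ⟨WithLp.toLp 2 ((p.1 : L2 n), symbMul hs 0 Ω ⟨p.1, hdom⟩),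
      (mem_formGraph hs).2 ⟨⟨p.1, hdom⟩, rfl, rfl⟩⟩
    have hk : k = ContinuousLinearMap.adjoint (formEmbedding hs Ω) (p.1 + p.2) := by
      refine ext_inner_left ℂ fun k' => ?_
      rw [ContinuousLinearMap.adjoint_inner_right, inner_add_right]
      obtain ⟨v, hv1, hv2⟩ := (mem_formGraph hs).1 k'.2
      rw [Submodule.coe_inner, Submodule.coe_inner, Submodule.coe_inner, coe_formEmbedding,
        WithLp.prod_inner_apply]
      have h1 := hp v v.2
      rw [fracForm_eq_inner hs v ⟨p.1, hdom⟩] at h1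
      change inner ℂ (k' : WithLp 2 (L2 n × L2 n)).fst (p.1 : L2 n) +
        inner ℂ (k' : WithLp 2 (L2 n × L2 n)).snd (symbMul hs 0 Ω ⟨p.1, hdom⟩) = _
      rw [← hv1, ← hv2, h1]
    rw [← hk]
    rfl
  · intro hp
    set k := ContinuousLinearMap.adjoint (formEmbedding hs Ω) (p.1 + p.2) with hk
    obtain ⟨u, hu1, hu2⟩ := (mem_formGraph hs).1 k.2
    have hpu : (p.1 : L2 n) = u := by rw [hp, coe_formEmbedding, hu1]
    refine ⟨hpu ▸ u.2, fun v hv => ?_⟩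
    rw [hpu, fracForm_eq_inner hs ⟨v, hv⟩ u]
    let k' : formGraph hs Ω := ⟨WithLp.toLp 2 (v, symbMul hs 0 Ω ⟨v, hv⟩),
      (mem_formGraph hs).2 ⟨⟨v, hv⟩, rfl, rfl⟩⟩
    have h1 : inner ℂ k' k = inner ℂ (formEmbedding hs Ω k') (p.1 + p.2) := by
      rw [hk, ContinuousLinearMap.adjoint_inner_right]
    rw [inner_add_right, Submodule.coe_inner, Submodule.coe_inner, Submodule.coe_inner,
      coe_formEmbedding, WithLp.prod_inner_apply] at h1
    change inner ℂ v (k : WithLp 2 (L2 n × L2 n)).fst +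
      inner ℂ (symbMul hs 0 Ω ⟨v, hv⟩) (k : WithLp 2 (L2 n × L2 n)).snd =
      inner ℂ v (p.1 : L2 n) + inner ℂ v (p.2 : L2 n) at h1
    rw [← hu1, ← hu2, hpu] at h1
    exact add_left_cancel h1

/-- A lower bound for the form is a lower bound for the spectrum. -/
theorem opSpectrum_fracLaplacian_subset {n : ℕ} {s : ℝ} (hs : s ∈ Ioo (0 : ℝ) 1) {Ω : Set (E n)}
    {Λ : ℝ} (hΛ : 0 ≤ Λ)
    (hbound : ∀ u : formDomain s Ω, Λ * ‖(u : L2 n)‖ ^ 2 ≤ ‖symbMul hs 0 Ω u‖ ^ 2) :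
    opSpectrum (fracLaplacian s Ω) ⊆ (fun t : ℝ => (t : ℂ)) '' Ici Λ := by
  intro z hz
  by_contra hcon
  set J := formEmbedding hs Ω with hJ
  have hJnorm : ‖J‖ ≤ √((1 + Λ)⁻¹) := by
    refine J.opNorm_le_bound (Real.sqrt_nonneg _) fun x => ?_
    obtain ⟨u, hu1, hu2⟩ := (mem_formGraph hs).1 x.2
    have h1 := hbound u
    have h2 : ‖x‖ ^ 2 = ‖(u : L2 n)‖ ^ 2 + ‖symbMul hs 0 Ω u‖ ^ 2 := by
      rw [hu1, hu2, ← WithLp.prod_norm_sq_eq_of_L2]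
      rfl
    have h3 : ‖J x‖ = ‖(u : L2 n)‖ := by
      rw [hu1, ← coe_formEmbedding]
      rfl
    rw [h3]
    refine (pow_le_pow_iff_left₀ (norm_nonneg _) (by positivity) two_ne_zero).1 ?_
    rw [mul_pow, Real.sq_sqrt (by positivity), inv_mul_eq_div, le_div_iff₀ (by positivity), h2]
    linarith
  have hnorm : ‖J ∘L ContinuousLinearMap.adjoint J‖ ≤ (1 + Λ)⁻¹ := by
    refine (ContinuousLinearMap.opNorm_comp_le _ _).trans ?_
    rw [LinearIsometryEquiv.norm_map]
    calc ‖J‖ * ‖J‖ ≤ √((1 + Λ)⁻¹) * √((1 + Λ)⁻¹) := by gcongr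
      _ = (1 + Λ)⁻¹ := Real.mul_self_sqrt (by positivity)
  refine hz (isRegularValue_of_isUnit (R₀ := J ∘L ContinuousLinearMap.adjoint J)
    (fun p => by rw [fracLaplacian_graph, mem_opGraph_iff hs])
    (isUnit_one_sub_smul (ContinuousLinearMap.isPositive_self_comp_adjoint J)
      (by positivity : 0 < 1 + Λ) hnorm fun r hr hzr => hcon ⟨r - 1, ?_, ?_⟩))
  · rw [mem_Ici]; linarith
  · simp only [Complex.ofReal_sub, ← hzr]; simp

/-! ### The lower bound on the tube and the ground state on the cross-section -/

theorem inner_self_eq_ofReal {H : Type*} [NormedAddCommGroup H] [InnerProductSpace ℂ H] (x : H) :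
    inner ℂ x x = ((‖x‖ ^ 2 : ℝ) : ℂ) := by
  rw [inner_self_eq_norm_sq_to_K]
  push_cast
  rfl

theorem norm_symbMul_mono {n : ℕ} {s : ℝ} (hs : s ∈ Ioo (0 : ℝ) 1) (t : ℝ) {Ω : Set (E n)}
    (u : formDomain s Ω) : ‖symbMul hs 0 Ω u‖ ≤ ‖symbMul hs t Ω u‖ := by
  refine Lp.norm_le_norm_of_ae_le ?_
  filter_upwards [coeFn_symbMul hs 0 u, coeFn_symbMul hs t u] with η h1 h2
  rw [h1, h2, norm_mul, norm_mul, Complex.norm_real, Complex.norm_real,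
    Real.norm_of_nonneg (rootSymb_nonneg _ _ _), Real.norm_of_nonneg (rootSymb_nonneg _ _ _)]
  gcongr
  exact rootSymb_mono hs.1 (by simpa using sq_nonneg t) η

/-- The form on the tube is bounded below by the ground energy of the cross-section, since it is
the integral of the fibre forms of the slices, which increase with the frequency. -/
theorem groundEnergy_mul_le_tube {d : ℕ} {s : ℝ} (hs : s ∈ Ioo (0 : ℝ) 1) {ω : Set (E d)}
    (u : formDomain s (tube ω)) :
    groundEnergy hs 0 ω * ‖(u : L2 (d + 1))‖ ^ 2 ≤ ‖symbMul hs 0 (tube ω) u‖ ^ 2 := by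
  rw [← Lp.norm_fourier_eq (u : L2 (d + 1)), norm_sq_eq_integral_slice,
    norm_sq_eq_integral_slice (symbMul hs 0 (tube ω) u), ← integral_const_mul]
  refine integral_mono_ae ((integrable_slice_sq _).const_mul _) (integrable_slice_sq _) ?_
  filter_upwards [ae_exists_slice_formDomain hs u] with ζ ⟨w, hw1, hw2⟩
  have h1 : ∫ η : E d, ‖(𝓕 (u : L2 (d + 1)) : L2 (d + 1)) (joinEquiv d (η, ζ))‖ ^ 2 =
      ‖(w : L2 d)‖ ^ 2 := by
    rw [norm_sq_eq_integral_fourier]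
    refine integral_congr_ae ?_
    filter_upwards [hw1] with η h
    rw [h]
  have h2 : ∫ η : E d, ‖symbMul hs 0 (tube ω) u (joinEquiv d (η, ζ))‖ ^ 2 =
      ‖symbMul hs ζ ω w‖ ^ 2 := by
    rw [norm_sq_eq_integral]
    refine integral_congr_ae ?_
    filter_upwards [hw2] with η h
    rw [h]
  simp only [h1, h2]
  refine (groundEnergy_mul_le hs 0 w).trans ?_
  gcongr
  exact norm_symbMul_mono hs ζ w

theorem exists_domain_of_mem_opGraph {n : ℕ} {s : ℝ} {Ω : Set (E n)}
    {p : formHilbert s Ω × formHilbert s Ω} (hp : p ∈ opGraph s Ω) :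
    ∃ y : (fracLaplacian s Ω).domain, (y : formHilbert s Ω) = p.1 ∧ fracLaplacian s Ω y = p.2 := by
  rw [← fracLaplacian_graph] at hp
  exact (LinearPMap.mem_graph_iff _).1 hp

theorem isLeast_isEigenvalue {n : ℕ} {s : ℝ} (hs : s ∈ Ioo (0 : ℝ) 1) {Ω : Set (E n)}
    (ho : IsOpen Ω) (hne : Ω.Nonempty) (hb : Bornology.IsBounded Ω) :
    IsLeast {t : ℝ | IsEigenvalue (fracLaplacian s Ω) (t : ℂ)} (groundEnergy hs 0 Ω) := by
  constructor
  · obtain ⟨φ, hφ, hmin⟩ := exists_groundState hs 0 ho hne hb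
    let x : formHilbert s Ω := ⟨φ, (formDomain s Ω).le_topologicalClosure φ.2⟩
    have hmem : (x, (groundEnergy hs 0 Ω : ℂ) • x) ∈ opGraph s Ω := by
      refine ⟨φ.2, fun v hv => ?_⟩
      rw [Submodule.coe_smul, inner_smul_right]
      exact (fracForm_eq_inner hs ⟨v, hv⟩ φ).trans (inner_symbMul_groundState hs 0 hφ hmin ⟨v, hv⟩)
    obtain ⟨y, hy1, hy2⟩ := exists_domain_of_mem_opGraph hmem
    refine ⟨y, ?_, by rw [hy2, hy1]⟩
    rw [hy1]
    intro h0
    have h1 : (φ : L2 n) = 0 := congrArg Subtype.val h0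
    rw [h1, norm_zero] at hφ
    exact zero_ne_one hφ
  · rintro t ⟨y, hy0, hy⟩
    have hmem := (fracLaplacian s Ω).mem_graph y
    rw [fracLaplacian_graph, hy] at hmem
    obtain ⟨h1, h2⟩ := hmem
    simp only at h1 h2
    set u : formDomain s Ω := ⟨((y : formHilbert s Ω) : L2 n), h1⟩ with hu
    have h3 := h2 u u.2
    rw [Submodule.coe_smul, inner_smul_right] at h3
    have h4 := (fracForm_eq_inner hs u u).symm.trans h3
    change inner ℂ _ _ = (t : ℂ) * inner ℂ (u : L2 n) (u : L2 n) at h4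
    rw [inner_self_eq_ofReal, inner_self_eq_ofReal] at h4
    have h5 : ‖symbMul hs 0 Ω u‖ ^ 2 = t * ‖(u : L2 n)‖ ^ 2 := by exact_mod_cast h4
    have h6 := groundEnergy_mul_le hs 0 u
    rw [h5] at h6
    refine le_of_mul_le_mul_right h6 ?_
    have : (u : L2 n) ≠ 0 := fun h => hy0 (Subtype.ext h)
    have := norm_pos_iff.2 this
    positivity

/-! ### Weyl sequences -/

/-- If `φ` is a ground state of the fibre at frequency `t` and `h` is a unit vector concentrated
near `t`, then `φ ⊗ 𝓕⁻¹ h` is an approximate eigenfunction on the tube. Its form differs from the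
fibre form by a multiplier that is uniformly small by the subadditivity of `x ↦ xˢ`. -/
theorem exists_approx_eigenvector {d : ℕ} {s : ℝ} (hs : s ∈ Ioo (0 : ℝ) 1) (t : ℝ) {ω : Set (E d)}
    {φ : formDomain s ω} (hφ : ‖(φ : L2 d)‖ = 1)
    (hmin : ‖symbMul hs t ω φ‖ ^ 2 = groundEnergy hs t ω) {h : L2R} (hh : ‖h‖ = 1) {δ : ℝ}
    (hδ : 0 ≤ δ)
    (hsupp : ∀ᵐ ζ : ℝ, h ζ ≠ 0 → ((2 * Real.pi) ^ 2 * |ζ ^ 2 - t ^ 2|) ^ s ≤ δ) :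
    ∃ y : (fracLaplacian s (tube ω)).domain,
      ((y : formHilbert s (tube ω)) : L2 (d + 1)) = tensor (φ : L2 d) (𝓕⁻ h : L2R) ∧
      ‖fracLaplacian s (tube ω) y -
        (groundEnergy hs t ω : ℂ) • (y : formHilbert s (tube ω))‖ ≤ δ := by
  set m := groundEnergy hs t ω with hm
  set u : L2 (d + 1) := tensor (φ : L2 d) (𝓕⁻ h : L2R) with hu
  have hFu : (𝓕 u : L2 (d + 1)) = tensor (𝓕 (φ : L2 d) : L2 d) h := by
    rw [hu, fourier_tensor, FourierTransform.fourier_fourierInv_eq]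
  have hFuc : ∀ᵐ p : E d × ℝ, (𝓕 u : L2 (d + 1)) (joinEquiv d p) =
      (𝓕 (φ : L2 d) : L2 d) p.1 * h p.2 := by
    rw [hFu]
    exact coeFn_tensor _ _
  have hnu : ‖u‖ = 1 := by
    rw [hu, norm_tensor, hφ, one_mul, ← hh]
    exact (Lp.fourierTransformₗᵢ ℝ ℂ).symm.norm_map h
  -- the multiplier by which the symbols at frequencies `ζ` and `t` differ
  set D : E (d + 1) → ℝ := fun x =>
    rootSymb s 0 x ^ 2 - rootSymb s t ((joinEquiv d).symm x).1 ^ 2 with hD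
  have hDj (p : E d × ℝ) : D (joinEquiv d p) = rootSymb s p.2 p.1 ^ 2 - rootSymb s t p.1 ^ 2 := by
    simp only [hD, rootSymb_joinEquiv, MeasurableEquiv.symm_apply_apply]
  have hDm : Measurable D :=
    ((continuous_rootSymb hs.1 0).measurable.pow_const 2).sub
      (((continuous_rootSymb hs.1 t).measurable.comp
        (measurable_fst.comp (joinEquiv d).symm.measurable)).pow_const 2)
  have hDle : ∀ᵐ x, ‖(D x : ℂ) * (𝓕 u : L2 (d + 1)) x‖ ≤ δ * ‖(𝓕 u : L2 (d + 1)) x‖ := by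
    refine ae_of_ae_joinEquiv ?_
    filter_upwards [hFuc, ae_snd hsupp] with p h1 h2
    rw [norm_mul, Complex.norm_real, hDj]
    by_cases h0 : h p.2 = 0
    · rw [h1, h0]; simp
    · gcongr
      exact (abs_rootSymb_sq_sub_le hs _ _ _).trans (h2 h0)
  have hDmemLp : MemLp (fun x => (D x : ℂ) * (𝓕 u : L2 (d + 1)) x) 2 volume :=
    (Lp.memLp (𝓕 u : L2 (d + 1))).of_le_mul
      ((Complex.measurable_ofReal.comp hDm).aestronglyMeasurable.mul (Lp.aestronglyMeasurable _))
      hDle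
  set G : L2 (d + 1) := hDmemLp.toLp _ with hG
  have hGc : ∀ᵐ x, G x = (D x : ℂ) * (𝓕 u : L2 (d + 1)) x := hDmemLp.coeFn_toLp
  have hGnorm : ‖G‖ ≤ δ := by
    have : ‖G‖ ≤ δ * ‖(𝓕 u : L2 (d + 1))‖ := by
      refine Lp.norm_le_mul_norm_of_ae_le_mul ?_
      filter_upwards [hGc, hDle] with x h1 h2
      rwa [h1]
    rwa [Lp.norm_fourier_eq, hnu, mul_one] at this
  -- `u` belongs to the form domain
  have hmemHs : MemHs s u := by
    rw [memHs_iff, ← memLp_joinEquiv]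
    have h1 := memLp_mul_prod (Lp.memLp (symbMul hs t ω φ)) (Lp.memLp h)
    have h2 := (memLp_mul_prod (Lp.memLp (𝓕 (φ : L2 d) : L2 d)) (Lp.memLp h)).norm.const_mul (√δ)
    refine (h1.norm.add h2).of_le ?_ ?_
    · exact ((Complex.continuous_ofReal.comp (continuous_rootSymb hs.1
        0)).measurable.comp (joinEquiv d).measurable).aestronglyMeasurable.mul
        (memLp_joinEquiv_coeFn _).1
    · filter_upwards [hFuc, ae_fst (coeFn_symbMul hs t φ), ae_snd hsupp] with p h3 h4 h5
      rw [h3, rootSymb_joinEquiv]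
      simp only [Pi.add_apply, h4, norm_mul, Complex.norm_real,
        Real.norm_of_nonneg (rootSymb_nonneg _ _ _)]
      by_cases h0 : h p.2 = 0
      · rw [h0]; simp
      have h6 : rootSymb s p.2 p.1 ≤ rootSymb s t p.1 + √δ := by
        refine abs_le_of_sq_le_sq' ?_ (add_nonneg (rootSymb_nonneg _ _ _) (Real.sqrt_nonneg _)) |>.2
        have h7 := le_of_abs_le ((abs_rootSymb_sq_sub_le hs p.2 t p.1).trans (h5 h0))
        nlinarith [Real.sq_sqrt hδ, mul_nonneg (rootSymb_nonneg s t p.1) (Real.sqrt_nonneg δ)]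
      rw [Real.norm_of_nonneg (by have := rootSymb_nonneg s t p.1; positivity), ← mul_assoc,
        ← mul_assoc, ← add_mul, ← add_mul]
      gcongr
  have hmem : u ∈ formDomain s (tube ω) := by
    refine ⟨hmemHs, ae_of_ae_joinEquiv ?_⟩
    filter_upwards [coeFn_tensor (φ : L2 d) (𝓕⁻ h : L2R), ae_fst φ.2.2] with p h1 h2 h3
    rw [joinEquiv_mem_closure_tube] at h3
    rw [h1, h2 h3, zero_mul]
  -- the weak form of the approximate eigenvalue equation
  have hweak (v : formDomain s (tube ω)) :
      inner ℂ (symbMul hs 0 (tube ω) v) (symbMul hs 0 (tube ω) ⟨u, hmem⟩) =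
        (m : ℂ) * inner ℂ (v : L2 (d + 1)) u + inner ℂ (v : L2 (d + 1)) (𝓕⁻ G : L2 (d + 1)) := by
    set V : L2 (d + 1) := 𝓕 (v : L2 (d + 1)) with hV
    set U : L2 (d + 1) := 𝓕 u
    set Φ : L2 d := 𝓕 (φ : L2 d)
    have hi1 := integrable_conj_mul (memLp_joinEquiv_coeFn (symbMul hs 0 (tube ω) v))
      (memLp_joinEquiv_coeFn (symbMul hs 0 (tube ω) ⟨u, hmem⟩))
    have hi2 := integrable_conj_mul (memLp_joinEquiv_coeFn V) (memLp_joinEquiv_coeFn G)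
    have hi3 := integrable_conj_mul (memLp_joinEquiv_coeFn V) (memLp_joinEquiv_coeFn U)
    have e1 : ∀ᵐ p : E d × ℝ, conj (symbMul hs 0 (tube ω) v (joinEquiv d p)) *
        symbMul hs 0 (tube ω) ⟨u, hmem⟩ (joinEquiv d p) -
        conj (V (joinEquiv d p)) * G (joinEquiv d p) =
        ((rootSymb s t p.1 ^ 2 : ℝ) : ℂ) * (conj (V (joinEquiv d p)) * (Φ p.1 * h p.2)) := by
      filter_upwards [ae_joinEquiv (coeFn_symbMul hs 0 v),
        ae_joinEquiv (coeFn_symbMul hs 0 ⟨u, hmem⟩), ae_joinEquiv hGc, hFuc] with p h1 h2 h3 h4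
      rw [h1, h2, h3, hDj, rootSymb_joinEquiv, h4, map_mul, Complex.conj_ofReal]
      push_cast
      ring
    have e2 : ∀ᵐ p : E d × ℝ, conj (V (joinEquiv d p)) * U (joinEquiv d p) =
        conj (V (joinEquiv d p)) * (Φ p.1 * h p.2) := by
      filter_upwards [hFuc] with p h1
      rw [h1]
    have hi12 := (hi1.sub hi2).congr e1
    have hi3' := hi3.congr e2
    have key : ∫ p : E d × ℝ,
        ((rootSymb s t p.1 ^ 2 : ℝ) : ℂ) * (conj (V (joinEquiv d p)) * (Φ p.1 * h p.2)) =
        (m : ℂ) * ∫ p : E d × ℝ, conj (V (joinEquiv d p)) * (Φ p.1 * h p.2) := by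
      refine (integral_prod_symm _ hi12).trans (Eq.trans ?_
        (congrArg ((m : ℂ) * ·) (integral_prod_symm _ hi3').symm))
      rw [← integral_const_mul]
      refine integral_congr_ae ?_
      filter_upwards [ae_exists_slice_formDomain hs v] with ζ ⟨w, hw, _⟩
      have h1 := inner_symbMul_groundState hs t hφ hmin w
      rw [← Lp.inner_fourier_eq (w : L2 d), inner_eq_integral, inner_eq_integral] at h1
      have h2 : ∫ η : E d, ((rootSymb s t η ^ 2 : ℝ) : ℂ) *
          (conj (V (joinEquiv d (η, ζ))) * (Φ η * h ζ)) =
          (∫ η : E d, conj (symbMul hs t ω w η) * symbMul hs t ω φ η) * h ζ := by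
        rw [← integral_mul_const]
        refine integral_congr_ae ?_
        filter_upwards [hw, coeFn_symbMul hs t w, coeFn_symbMul hs t φ] with η h3 h4 h5
        rw [← h3, h4, h5, map_mul, Complex.conj_ofReal]
        push_cast
        ring
      have h3 : ∫ η : E d, conj (V (joinEquiv d (η, ζ))) * (Φ η * h ζ) =
          (∫ η : E d, conj ((𝓕 (w : L2 d) : L2 d) η) * Φ η) * h ζ := by
        rw [← integral_mul_const]
        refine integral_congr_ae ?_
        filter_upwards [hw] with η h3
        rw [← h3, mul_assoc]
      simp only [h2, h3, h1, mul_assoc]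
      rfl
    rw [← Lp.inner_fourier_eq (v : L2 (d + 1)) u,
      ← Lp.inner_fourier_eq (v : L2 (d + 1)) (𝓕⁻ G : L2 (d + 1)),
      FourierTransform.fourier_fourierInv_eq, ← sub_eq_iff_eq_add, inner_eq_integral_joinEquiv,
      inner_eq_integral_joinEquiv, inner_eq_integral_joinEquiv, ← integral_sub hi1 hi2,
      integral_congr_ae e1, key, integral_congr_ae e2]
  set x : formHilbert s (tube ω) := ⟨u, (formDomain s (tube ω)).le_topologicalClosure hmem⟩
  -- `formHilbert` may be a proper subspace of `L₂`, so the error term has to be projected to it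
  set g : formHilbert s (tube ω) :=
    (formDomain s (tube ω)).topologicalClosure.orthogonalProjectionOnto (𝓕⁻ G : L2 (d + 1)) with hg
  have hgraph : (x, (m : ℂ) • x + g) ∈ opGraph s (tube ω) := by
    refine ⟨hmem, fun v hv => ?_⟩
    have h1 := Submodule.inner_orthogonalProjectionOnto_eq_of_mem_left
      (⟨v, (formDomain s (tube ω)).le_topologicalClosure hv⟩ : formHilbert s (tube ω))
      (𝓕⁻ G : L2 (d + 1))
    rw [Submodule.coe_inner] at h1
    change inner ℂ v (g : L2 (d + 1)) = _ at h1
    rw [Submodule.coe_add, Submodule.coe_smul, inner_add_right, inner_smul_right, h1]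
    exact (fracForm_eq_inner hs ⟨v, hv⟩ ⟨u, hmem⟩).trans (hweak ⟨v, hv⟩)
  obtain ⟨y, hy1, hy2⟩ := exists_domain_of_mem_opGraph hgraph
  refine ⟨y, by rw [hy1], ?_⟩
  rw [hy1, hy2, add_sub_cancel_left]
  refine (Submodule.norm_orthogonalProjectionOnto_apply_le _ _).trans ?_
  exact ((Lp.fourierTransformₗᵢ (E (d + 1)) ℂ).symm.norm_map G).trans_le hGnorm

/-- An orthonormal sequence concentrating at `t`: normalized indicator functions of the disjoint
intervals `(t + 1/(k+2), t + 1/(k+1))`. -/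
theorem exists_orthonormal_concentrating (t : ℝ) : ∃ h : ℕ → L2R, Orthonormal ℂ h ∧
    ∀ k : ℕ, ∀ᵐ ζ : ℝ, h k ζ ≠ 0 → |ζ - t| ≤ 1 / ((k : ℝ) + 1) := by
  set I : ℕ → Set ℝ := fun k => Ioo (t + 1 / ((k : ℝ) + 2)) (t + 1 / ((k : ℝ) + 1)) with hI
  have hIm (k : ℕ) : MeasurableSet (I k) := measurableSet_Ioo
  have hIf (k : ℕ) : volume (I k) ≠ ⊤ := measure_Ioo_lt_top.ne
  have hlt (k : ℕ) : 1 / ((k : ℝ) + 2) < 1 / ((k : ℝ) + 1) := by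
    apply one_div_lt_one_div_of_lt <;> linarith [(Nat.cast_nonneg k : (0 : ℝ) ≤ k)]
  have hvol (k : ℕ) : 0 < volume.real (I k) := by
    rw [hI, Real.volume_real_Ioo_of_le (by linarith [hlt k])]
    linarith [hlt k]
  have hdisj {j k : ℕ} (hjk : j < k) : I j ∩ I k = ∅ := by
    rw [← disjoint_iff_inter_eq_empty, hI, Ioo_disjoint_Ioo]
    refine (min_le_right _ _).trans (le_trans ?_ (le_max_left _ _))
    have : (j : ℝ) + 1 ≤ k := by exact_mod_cast hjk
    have h2 : 1 / ((k : ℝ) + 1) ≤ 1 / ((j : ℝ) + 2) := by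
      apply one_div_le_one_div_of_le <;> linarith [(Nat.cast_nonneg j : (0 : ℝ) ≤ j)]
    linarith
  refine ⟨fun k => indicatorConstLp 2 (hIm k) (hIf k) (((√(volume.real (I k)))⁻¹ : ℝ) : ℂ), ?_,
    fun k => ?_⟩
  · rw [orthonormal_iff_ite]
    intro j k
    rw [L2.inner_indicatorConstLp_indicatorConstLp (hIm j) (hIm k) (hIf j) (hIf k)]
    rcases lt_trichotomy j k with hjk | rfl | hjk
    · rw [hdisj hjk, if_neg hjk.ne]; simp
    · rw [inter_self, if_pos rfl, inner_self_eq_ofReal, Complex.norm_real,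
        Real.norm_of_nonneg (by positivity), Complex.real_smul]
      have h1 : volume.real (I j) * ((√(volume.real (I j)))⁻¹) ^ 2 = 1 := by
        rw [inv_pow, Real.sq_sqrt (hvol j).le, mul_inv_cancel₀ (hvol j).ne']
      exact_mod_cast h1
    · rw [inter_comm, hdisj hjk, if_neg hjk.ne']; simp
  · filter_upwards [indicatorConstLp_coeFn (p := 2) (hs := hIm k) (hμs := hIf k)
      (c := (((√(volume.real (I k)))⁻¹ : ℝ) : ℂ))] with ζ h1 h2
    rw [h1] at h2
    have h3 := mem_of_indicator_ne_zero h2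
    have h4 : (0 : ℝ) ≤ 1 / ((k : ℝ) + 2) := by positivity
    rw [abs_le]
    constructor <;> linarith [h3.1, h3.2, hlt k]

/-- Approximate eigenfunctions with disjoint supports in the frequency `ζ` form a Weyl sequence. -/
theorem groundEnergy_mem_essSpectrum {d : ℕ} {s : ℝ} (hs : s ∈ Ioo (0 : ℝ) 1) (t : ℝ)
    {ω : Set (E d)} (ho : IsOpen ω) (hne : ω.Nonempty) (hb : Bornology.IsBounded ω) :
    (groundEnergy hs t ω : ℂ) ∈ essSpectrum (fracLaplacian s (tube ω)) := by
  obtain ⟨φ, hφ, hmin⟩ := exists_groundState hs t ho hne hb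
  obtain ⟨h, hon, hsupp⟩ := exists_orthonormal_concentrating t
  set δ : ℕ → ℝ := fun k =>
    ((2 * Real.pi) ^ 2 * (1 / ((k : ℝ) + 1) * (2 * |t| + 1))) ^ s with hδ
  have hδ0 : Tendsto δ atTop (𝓝 0) := by
    have hc : Continuous fun x : ℝ => ((2 * Real.pi) ^ 2 * (x * (2 * |t| + 1))) ^ s :=
      Continuous.rpow_const (by fun_prop) fun _ => Or.inr hs.1.le
    have := (hc.tendsto 0).comp (tendsto_one_div_add_atTop_nhds_zero_nat (𝕜 := ℝ))
    simp only [zero_mul, mul_zero, Real.zero_rpow hs.1.ne'] at this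
    exact this
  have hk (k : ℕ) : ∀ᵐ ζ : ℝ, h k ζ ≠ 0 → ((2 * Real.pi) ^ 2 * |ζ ^ 2 - t ^ 2|) ^ s ≤ δ k := by
    filter_upwards [hsupp k] with ζ h1 h2
    have h3 := h1 h2
    have h4 : |ζ + t| ≤ 2 * |t| + 1 := by
      have h5 : 1 / ((k : ℝ) + 1) ≤ 1 := by
        rw [div_le_one (by positivity)]
        linarith [(Nat.cast_nonneg k : (0 : ℝ) ≤ k)]
      calc |ζ + t| = |(ζ - t) + 2 * t| := by congr 1; ring
        _ ≤ |ζ - t| + |2 * t| := abs_add_le _ _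
        _ ≤ 2 * |t| + 1 := by rw [abs_mul, abs_two]; linarith
    have h6 : |ζ ^ 2 - t ^ 2| = |ζ - t| * |ζ + t| := by
      rw [← abs_mul]; congr 1; ring
    have := hs.1
    simp only [h6, hδ]
    gcongr
  choose y hy1 hy2 using fun k => exists_approx_eigenvector hs t hφ hmin (hon.1 k)
    (by positivity : 0 ≤ δ k) (hk k)
  refine ⟨y, ?_, squeeze_zero (fun _ => norm_nonneg _) hy2 hδ0⟩
  rw [orthonormal_iff_ite]
  intro j k
  rw [Submodule.coe_inner, hy1, hy1, inner_tensor, inner_self_eq_ofReal, hφ]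
  have h1 : inner ℂ (𝓕⁻ (h j) : L2R) (𝓕⁻ (h k) : L2R) = inner ℂ (h j) (h k) :=
    (Lp.fourierTransformₗᵢ ℝ ℂ).symm.inner_map_map _ _
  rw [h1, orthonormal_iff_ite.1 hon j k]
  simp

end FracTube

end

theorem theoremT (d : ℕ) (hd : 1 ≤ d) (s : ℝ) (hs : s ∈ Set.Ioo (0 : ℝ) 1)
    (ω : Set (FracTube.E d)) (hopen : IsOpen ω) (hconn : IsConnected ω)
    (hbdd : Bornology.IsBounded ω) :
    ∃ Λ : ℝ,
      IsLeast {t : ℝ | FracTube.IsEigenvalue (FracTube.fracLaplacian s ω) (t : ℂ)} Λ ∧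
      FracTube.opSpectrum (FracTube.fracLaplacian s (FracTube.tube ω)) =
        (fun t : ℝ => (t : ℂ)) '' Set.Ici Λ ∧
      FracTube.essSpectrum (FracTube.fracLaplacian s (FracTube.tube ω)) =
        (fun t : ℝ => (t : ℂ)) '' Set.Ici Λ := by
  have hne := hconn.nonempty
  have h1 := FracTube.opSpectrum_fracLaplacian_subset hs (FracTube.groundEnergy_nonneg hs 0 ω)
    (FracTube.groundEnergy_mul_le_tube hs)
  have h2 := FracTube.essSpectrum_subset_opSpectrum (FracTube.fracLaplacian s (FracTube.tube ω))
  have h3 : (fun t : ℝ => (t : ℂ)) '' Set.Ici (FracTube.groundEnergy hs 0 ω) ⊆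
      FracTube.essSpectrum (FracTube.fracLaplacian s (FracTube.tube ω)) := by
    rintro _ ⟨r, hr, rfl⟩
    obtain ⟨t, rfl⟩ := FracTube.exists_groundEnergy_eq hs hopen hne hbdd hr
    exact FracTube.groundEnergy_mem_essSpectrum hs t hopen hne hbdd
  exact ⟨FracTube.groundEnergy hs 0 ω, FracTube.isLeast_isEigenvalue hs hopen hne hbdd,
    Set.Subset.antisymm h1 (h3.trans h2), Set.Subset.antisymm (h2.trans h1) h3⟩
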